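/- Let $G=(\mathcal X,\Sigma,P)$ be a context-free grammar with a finite set $\mathcal X$ of $n$ variables, a finite alphabet $\Sigma$ and a finite set $P$ of rules, let $X\in\mathcal X$, and let $k\ge 1$ be an integer. *Commutative ambiguity.* An $X$-tree is a finite ordered derivation tree whose root is labelled by a rule $X\to u_0X_1u_1\cdots X_ru_r$ ($u_i\in\Sigma^*$, $X_i\in\mathcal X$) and whose $i$-th child is an $X_i$-tree; its yield is $u_0w_1u_1\cdots w_ru_r$, where $w_i$ is the yield of the $i$-th child. For $v\in\mathbb N^\Sigma$ let $\mathrm{camb}_{X}(v)\in\mathbb N\cup\{\infty\}$ be the number of $X$-trees whose yield has Parikh vector $v$ (the vector of the numbers of occurrences of the letters). *Unfolding.* For $d\in\mathbb N$ the grammar $G^{\le d}$ over $\Sigma$ has the variables $Y^{\le e},Y^{=e}$ ($Y\in\mathcal X$, $0\le e\le d$) and exactly the following rules: (a) $Y^{\le e}\to Y^{=e'}$ for $0\le e'\le e\le d$; (b) $Y^{=0}\to u_0$ for each rule $Y\to u_0$ of $G$ with $u_0\in\Sigma^*$; (c) $Y^{=e}\to u_0X_1^{=e}u_1$ for each rule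 $Y\to u_0X_1u_1$ of $G$ and $0\le e\le d$; (d) for each rule $Y\to u_0X_1u_1\cdots X_ru_r$ of $G$ with $r>1$ and each $1\le e\le d$, the rules $Y^{=e}\to u_0Z_1u_1\cdots Z_ru_r$ where either, for some $j$, $Z_j=X_j^{=e}$ and $Z_i=X_i^{\le e-1}$ for all $i\ne j$; or, for some $J\subseteq\{1,\dots,r\}$ with $|J|\ge2$, $Z_i=X_i^{=e-1}$ for $i\in J$ and $Z_i=X_i^{\le e-2}$ for $i\notin J$, provided that all these variables are defined (that is, $e\ge2$ or $J=\{1,\dots,r\}$). Write $\mathrm{camb}_{X^{\le d}}$ for the commutative ambiguity of the variable $X^{\le d}$ in the grammar $G^{\le d}$. *Series modulo $k=k+1$.* Let $\mathbb N_k=\{0,1,\dots,k\}$ be the semiring with the addition and multiplication of $\mathbb N$ cut off at $k$ (so $k$ plays the role of $\infty$), and let $\mathbb N_k\langle\langle\mathbb N^\Sigma\rangle\rangle$ be the semiring of all functions $\mathbb N^\Sigma\to\mathbb N_k$ with pointwise addition and the Cauchy product. Functions $\mathbb N^\Sigma\to\mathbb N\cup\{\infty\}$ are viewed in it by applying $x\mapsto\min(x,k)$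 to each value. A series in $\mathbb N_k\langle\langle\mathbb N^\Sigma\rangle\rangle$ is rational if it is obtained from elements of $\mathbb N_k$ and of $\mathbb N^\Sigma$ by finitely many applications of addition, multiplication and Kleene star $a^*=\sum_{i\in\mathbb N}a^i$ (the supremum of the partial sums in the natural order). Put $\ell(k)=\lceil\log_2\log_2k\rceil$ for $k\ge2$ and $\ell(1)=0$. Then in $\mathbb N_k\langle\langle\mathbb N^\Sigma\rangle\rangle$ $$\mathrm{camb}_{X^{\le n+\ell(k)}}=\mathrm{camb}_X ,$$ and $\mathrm{camb}_X$ is rational in $\mathbb N_k\langle\langle\mathbb N^\Sigma\rangle\rangle$. -/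

import Mathlib

/-! ### The collapsed natural numbers -/

/-- The set `ℕ_k = {0, 1, …, k}` of natural numbers collapsed at `k`. -/
def CollapsedNat (k : ℕ) : Type := {n : ℕ // n ≤ k}

namespace CollapsedNat

/-- The projection `ℕ → ℕ_k`, which identifies all numbers `≥ k` with `k`. -/
def ofNat (k n : ℕ) : CollapsedNat k := ⟨min n k, min_le_right n k⟩

/-- The projection `ℕ ∪ {∞} → ℕ_k`, which identifies `∞` and all numbers `≥ k` with `k`. -/
noncomputable def ofENat (k : ℕ) (x : ℕ∞) : CollapsedNat k := ofNat k (min x (k : ℕ∞)).toNat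

instance (k : ℕ) : Zero (CollapsedNat k) := ⟨ofNat k 0⟩
instance (k : ℕ) : One (CollapsedNat k) := ⟨ofNat k 1⟩
instance (k : ℕ) : Add (CollapsedNat k) := ⟨fun a b => ofNat k (a.1 + b.1)⟩
instance (k : ℕ) : Mul (CollapsedNat k) := ⟨fun a b => ofNat k (a.1 * b.1)⟩
instance (k : ℕ) : SMul ℕ (CollapsedNat k) := ⟨fun n a => ofNat k (n * a.1)⟩
instance (k : ℕ) : Pow (CollapsedNat k) ℕ := ⟨fun a n => ofNat k (a.1 ^ n)⟩
instance (k : ℕ) : NatCast (CollapsedNat k) := ⟨ofNat k⟩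

theorem ofNat_surjective (k : ℕ) : Function.Surjective (ofNat k) := fun a =>
  ⟨a.1, Subtype.ext (min_eq_left a.2)⟩

theorem ofNat_add (k m n : ℕ) : ofNat k (m + n) = ofNat k m + ofNat k n := by
  apply Subtype.ext
  change min (m + n) k = min (min m k + min n k) k
  omega

theorem min_mul_min (k m n : ℕ) : min (m * n) k = min (min m k * min n k) k := by
  rcases Nat.eq_zero_or_pos m with rfl | hm
  · simp
  rcases Nat.eq_zero_or_pos n with rfl | hn
  · simp
  rcases le_total m k with h | h <;> rcases le_total n k with h' | h'
  · rw [min_eq_left h, min_eq_left h']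
  · rw [min_eq_left h, min_eq_right h', min_eq_right, min_eq_right] <;> nlinarith
  · rw [min_eq_right h, min_eq_left h', min_eq_right, min_eq_right] <;> nlinarith
  · rw [min_eq_right h, min_eq_right h', min_eq_right (by nlinarith)]
    rcases Nat.eq_zero_or_pos k with rfl | hk
    · simp
    · rw [min_eq_right]; nlinarith

theorem ofNat_mul (k m n : ℕ) : ofNat k (m * n) = ofNat k m * ofNat k n :=
  Subtype.ext (min_mul_min k m n)

theorem ofNat_nsmul (k n m : ℕ) : ofNat k (n • m) = n • ofNat k m := by
  apply Subtype.ext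
  change min (n * m) k = min (n * min m k) k
  rw [min_mul_min k n m, min_mul_min k n (min m k), min_eq_left (min_le_right m k)]

theorem ofNat_pow (k m n : ℕ) : ofNat k (m ^ n) = ofNat k m ^ n := by
  apply Subtype.ext
  change min (m ^ n) k = min (min m k ^ n) k
  induction n with
  | zero => simp
  | succ n ih =>
    rw [pow_succ, pow_succ, min_mul_min, ih, min_mul_min k (min m k ^ n) (min m k),
      min_eq_left (min_le_right m k)]

/-- Addition and multiplication on `ℕ_k` are those of `ℕ`, cut off at `k`; in other words
`k` plays the role of `∞`. -/
instance (k : ℕ) : CommSemiring (CollapsedNat k) :=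
  (ofNat_surjective k).commSemiring (ofNat k) rfl rfl (ofNat_add k) (ofNat_mul k)
    (fun n x => ofNat_nsmul k n x) (fun x n => ofNat_pow k x n) (fun _ => rfl)

end CollapsedNat

/-! ### Kleene star and rational power series -/

/-- The natural preorder of a semiring: `a` is below `b` if `a + d = b` for some `d`. -/
def NaturalLE {S : Type*} [Semiring S] (a b : S) : Prop := ∃ d, a + d = b

/-- `s` is the Kleene star `a* = ∑_{i ∈ ℕ} a ^ i`, i.e. the supremum of the partial sums with
respect to the natural order. -/
def IsKleeneStar {S : Type*} [Semiring S] (a s : S) : Prop :=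
  (∀ n : ℕ, NaturalLE (∑ i ∈ Finset.range n, a ^ i) s) ∧
    ∀ u : S, (∀ n : ℕ, NaturalLE (∑ i ∈ Finset.range n, a ^ i) u) → NaturalLE s u

/-- Rational power series in `R⟨⟨ℕ^σ⟩⟩` (with the Cauchy product): those obtained from the
elements of `R` and of the monoid `ℕ^σ` by addition, multiplication and Kleene star. -/
inductive IsRationalSeries {σ R : Type*} [CommSemiring R] : MvPowerSeries σ R → Prop
  | const (c : R) : IsRationalSeries (MvPowerSeries.C c)
  | monom (v : σ →₀ ℕ) : IsRationalSeries (MvPowerSeries.monomial v (1 : R))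
  | add {a b : MvPowerSeries σ R} :
      IsRationalSeries a → IsRationalSeries b → IsRationalSeries (a + b)
  | mul {a b : MvPowerSeries σ R} :
      IsRationalSeries a → IsRationalSeries b → IsRationalSeries (a * b)
  | star {a s : MvPowerSeries σ R} :
      IsRationalSeries a → IsKleeneStar a s → IsRationalSeries s

/-! ### Derivation trees and commutative ambiguity -/

/-- The list `X₁, …, X_r` of the variables occurring in `γ = u₀ X₁ u₁ … X_r u_r`. -/
def varsOf {T N : Type*} : List (Symbol T N) → List N
  | [] => []
  | Symbol.terminal _ :: γ => varsOf γ
  | Symbol.nonterminal X :: γ => X :: varsOf γ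

/-- For `γ = u₀ X₁ u₁ … X_r u_r`, the list `u₀ w₁ u₁ … w_r u_r`, with the letters of the words
`u_i` mapped by `f`. -/
def plugIn {T N β : Type*} (f : T → β) :
    (γ : List (Symbol T N)) → (Fin (varsOf γ).length → List β) → List β
  | [], _ => []
  | Symbol.terminal a :: γ, w => f a :: plugIn f γ w
  | Symbol.nonterminal _ :: γ, w =>
      w ⟨0, Nat.succ_pos _⟩ ++ plugIn f γ (fun i => w i.succ)

/-- The derivation trees `σ_{X,γ} t₁ … t_r` of a context-free grammar, indexed by the variable `X`
that is rewritten at the root: a node is a rule `X → u₀ X₁ u₁ … X_r u_r` and its `i`-th child is a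
derivation tree for `X_i`. -/
inductive DerivTree {T : Type*} (G : ContextFreeGrammar T) : G.NT → Type _
  | node (r : ContextFreeRule T G.NT) (hr : r ∈ G.rules)
      (t : (i : Fin (varsOf r.output).length) → DerivTree G ((varsOf r.output).get i)) :
      DerivTree G r.input

/-- The word represented by a derivation tree. -/
def DerivTree.yield {T : Type*} {G : ContextFreeGrammar T} : {X : G.NT} → DerivTree G X → List T
  | _, .node r _ t => plugIn id r.output (fun i => (t i).yield)

/-- The Parikh vector of a word: it counts the occurrences of every letter. -/
noncomputable def parikhVector {T : Type*} (w : List T) : T →₀ ℕ :=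
  (w.map (fun a => Finsupp.single a 1)).sum

/-- The commutative ambiguity of `(G, X)`, as a power series in `(ℕ ∪ {∞})⟨⟨ℕ^T⟩⟩`: it assigns to
`v` the number of `X`-trees whose yield has Parikh vector `v`. -/
noncomputable def camb {T : Type*} (G : ContextFreeGrammar T) (X : G.NT) : MvPowerSeries T ℕ∞ :=
  fun v => {t : DerivTree G X | parikhVector t.yield = v}.encard

/-- The commutative ambiguity of `(G, X)` in `ℕ_k⟨⟨ℕ^T⟩⟩`. -/
noncomputable def cambMod {T : Type*} (k : ℕ) (G : ContextFreeGrammar T) (X : G.NT) :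
    MvPowerSeries T (CollapsedNat k) :=
  fun v => CollapsedNat.ofENat k (camb G X v)

/-! ### Unfolding a grammar -/

/-- The variables `X^{≤ d}` and `X^{= d}` (`X ∈ N`, `0 ≤ d ≤ k`) of the `k`-th unfolding. -/
inductive UnfoldVar (N : Type) (k : ℕ) : Type
  | atMost (X : N) (d : Fin (k + 1)) : UnfoldVar N k
  | exactly (X : N) (d : Fin (k + 1)) : UnfoldVar N k

/-- For `γ = u₀ X₁ u₁ … X_r u_r`, the list `u₀ Z₁ u₁ … Z_r u_r`. -/
def relabel {T N N' : Type*} (γ : List (Symbol T N)) (Z : Fin (varsOf γ).length → N') :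
    List (Symbol T N') :=
  plugIn Symbol.terminal γ (fun i => [Symbol.nonterminal (Z i)])

open UnfoldVar in
/-- The rules of the `k`-th unfolding of a set `P` of context-free rules. -/
inductive UnfoldRule {T : Type*} {N : Type} (P : Finset (ContextFreeRule T N)) (k : ℕ) :
    ContextFreeRule T (UnfoldVar N k) → Prop
  /-- `X^{≤ d} → X^{= e}` for `e ≤ d`. -/
  | choose (X : N) (d e : Fin (k + 1)) (h : e ≤ d) :
      UnfoldRule P k ⟨atMost X d, [Symbol.nonterminal (exactly X e)]⟩
  /-- `X^{= 0} → u₀` for every rule `X → u₀`. -/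
  | leaf (r : ContextFreeRule T N) (hr : r ∈ P) (h : (varsOf r.output).length = 0) :
      UnfoldRule P k
        ⟨exactly r.input 0, relabel r.output (fun i => exactly ((varsOf r.output).get i) 0)⟩
  /-- `X^{= d} → u₀ X₁^{= d} u₁` for every rule `X → u₀ X₁ u₁`. -/
  | unary (r : ContextFreeRule T N) (hr : r ∈ P) (h : (varsOf r.output).length = 1)
      (d : Fin (k + 1)) :
      UnfoldRule P k
        ⟨exactly r.input d, relabel r.output (fun i => exactly ((varsOf r.output).get i) d)⟩
  /-- `X^{= d} → u₀ Z₁ u₁ … Z_r u_r` for every rule `X → u₀ X₁ u₁ … X_r u_r` with `r > 1`,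
  every `1 ≤ d ≤ k` and every `j`, where `Z_j = X_j^{= d}` and `Z_i = X_i^{≤ d - 1}` for `i ≠ j`. -/
  | single (r : ContextFreeRule T N) (hr : r ∈ P) (h : 1 < (varsOf r.output).length)
      (d e : Fin (k + 1)) (hd : (e : ℕ) + 1 = d) (j : Fin (varsOf r.output).length) :
      UnfoldRule P k
        ⟨exactly r.input d, relabel r.output (fun i =>
          if i = j then exactly ((varsOf r.output).get i) d
          else atMost ((varsOf r.output).get i) e)⟩
  /-- `X^{= d} → u₀ Z₁ u₁ … Z_r u_r` for every rule `X → u₀ X₁ u₁ … X_r u_r` with `r > 1`,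
  every `1 ≤ d ≤ k` and every set `J` of at least two indices, where `Z_i = X_i^{= d - 1}` for
  `i ∈ J` and `Z_i = X_i^{≤ d - 2}` for `i ∉ J`, provided that all `Z_i` are defined. -/
  | multi (r : ContextFreeRule T N) (hr : r ∈ P) (h : 1 < (varsOf r.output).length)
      (d : Fin (k + 1)) (J : Finset (Fin (varsOf r.output).length)) (hJ : 2 ≤ J.card)
      (Z : Fin (varsOf r.output).length → UnfoldVar N k)
      (hZ : ∀ i ∈ J, ∃ e : Fin (k + 1), (e : ℕ) + 1 = d ∧
        Z i = exactly ((varsOf r.output).get i) e)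
      (hZ' : ∀ i ∉ J, ∃ e : Fin (k + 1), (e : ℕ) + 2 = d ∧
        Z i = atMost ((varsOf r.output).get i) e) :
      UnfoldRule P k ⟨exactly r.input d, relabel r.output Z⟩

instance UnfoldVar.instFinite (N : Type) [Finite N] (k : ℕ) : Finite (UnfoldVar N k) := by
  refine Finite.of_surjective (α := (N × Fin (k + 1)) ⊕ (N × Fin (k + 1)))
    (Sum.elim (fun p => .atMost p.1 p.2) (fun p => .exactly p.1 p.2)) ?_
  rintro (⟨X, d⟩ | ⟨X, d⟩)
  · exact ⟨Sum.inl (X, d), rfl⟩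
  · exact ⟨Sum.inr (X, d), rfl⟩

theorem finite_setOf_unfoldRule {T : Type*} {N : Type} [Finite N]
    (P : Finset (ContextFreeRule T N)) (k : ℕ) : {s | UnfoldRule P k s}.Finite := by
  let A : Set (ContextFreeRule T (UnfoldVar N k)) :=
    Set.range (fun p : UnfoldVar N k × UnfoldVar N k => ⟨p.1, [Symbol.nonterminal p.2]⟩)
  let B : P → Set (ContextFreeRule T (UnfoldVar N k)) := fun r =>
    Set.range (fun p : UnfoldVar N k × (Fin (varsOf r.1.output).length → UnfoldVar N k) =>
      ⟨p.1, relabel r.1.output p.2⟩)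
  have hfin : (A ∪ ⋃ r, B r).Finite :=
    (Set.finite_range _).union (Set.finite_iUnion fun r => Set.finite_range _)
  refine hfin.subset ?_
  rintro _ (⟨X, d, e, h⟩ | ⟨r, hr, h⟩ | ⟨r, hr, h, d⟩ | ⟨r, hr, h, d, e, hd, j⟩ |
    ⟨r, hr, h, d, J, hJ, Z, hZ, hZ'⟩)
  · exact Or.inl ⟨(_, _), rfl⟩
  all_goals exact Or.inr (Set.mem_iUnion.2 ⟨⟨r, hr⟩, ⟨(_, _), rfl⟩⟩)

/-- The `k`-th unfolding `G^{≤ k}` of a context-free grammar `G`. -/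
noncomputable def unfoldGrammar {T : Type*} (G : ContextFreeGrammar T) [Finite G.NT] (k : ℕ) :
    ContextFreeGrammar T where
  NT := UnfoldVar G.NT k
  initial := UnfoldVar.atMost G.initial (Fin.last k)
  rules := (finite_setOf_unfoldRule G.rules k).toFinset

/-- The commutative ambiguity of `X^{≤ d}` in the grammar `G^{≤ d}`, in `ℕ_k⟨⟨ℕ^T⟩⟩`. -/
noncomputable def cambModAtMost {T : Type*} (k : ℕ) (G : ContextFreeGrammar T) [Finite G.NT]
    (X : G.NT) (d : ℕ) : MvPowerSeries T (CollapsedNat k) :=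
  cambMod k (unfoldGrammar G d) (UnfoldVar.atMost X (Fin.last d))

/-- `log log k` to base `2`, rounded up to a natural number; it is `0` for `k = 1` and `k = 2`. -/
noncomputable def logLog (k : ℕ) : ℕ := ⌈Real.logb 2 (Real.logb 2 (k : ℝ))⌉₊

/-!
The *dimension* of a derivation tree is its Strahler number. A tree whose dimension exceeds the
number of variables occurring in it contains two disjoint subtrees in each of which a variable
repeats along a path; the context between two such occurrences can be cut out of one of them and
pasted into the other. This changes the tree but not the multiset of its rules, hence not the Parikh
vector of its yield, and, if done suitably, leads to at least two different trees with the given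
multiset of rules whose dimension is at most the number `n` of variables. A tree of dimension larger
than `n + l + 1` contains a node with two children of dimension exactly `n + l + 1`, and choosing
their replacements independently squares the number of variants; so a tree of dimension larger than
`n + l` has `2 ^ 2 ^ l` variants of dimension at most `n + l`. Counting only up to `k`, one
therefore does not see trees of dimension larger than `n + log log k`, and the unfolded grammar
derives exactly the trees of bounded dimension.

A tree of dimension `e` has at most one child of dimension `e`, and so the generating series of
these trees form the least solution of a linear system whose coefficients are polynomials in the
series of smaller dimension. Over `ℕ_k` ascending chains become stationary, which makes the
star of a series computable coefficientwise and least solutions compatible with the truncation;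
eliminating the unknowns one at a time by `x = a x + b ↦ x = a^* b` expresses the solution
rationally.
-/

noncomputable section

/-! ### Strahler numbers -/

section Strahler

variable {ι : Type*} [Fintype ι]

open Classical in
/-- The dimension of a node of a tree whose children have the dimensions `δ i`: the largest of
these numbers, plus one if it is attained at least twice. -/
def strahler (δ : ι → ℕ) : ℕ :=
  if {i | δ i = Finset.univ.sup δ}.Subsingleton then Finset.univ.sup δ else Finset.univ.sup δ + 1

theorem strahler_le_iff {δ : ι → ℕ} {D : ℕ} :
    strahler δ ≤ D ↔ (∀ i, δ i ≤ D) ∧ {i | δ i = D}.Subsingleton := by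
  have sup_le_iff : ∀ {D}, Finset.univ.sup δ ≤ D ↔ ∀ i, δ i ≤ D := by simp
  have eq_sup : ∀ {D i}, Finset.univ.sup δ ≤ D → δ i = D → Finset.univ.sup δ = D :=
    fun hD hi => hD.antisymm (hi ▸ Finset.le_sup (Finset.mem_univ _))
  unfold strahler
  split_ifs with h
  · refine ⟨fun hD => ⟨sup_le_iff.1 hD, fun i hi => ?_⟩, fun hD => sup_le_iff.2 hD.1⟩
    exact (eq_sup hD hi ▸ h) hi
  · refine ⟨fun hD => ⟨sup_le_iff.1 (by omega), fun i hi => ?_⟩, fun ⟨hD, hs⟩ => ?_⟩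
    · have := eq_sup (by omega) hi
      omega
    · refine (sup_le_iff.2 hD).lt_of_ne fun hsup => h ?_
      rwa [hsup]

theorem le_strahler (δ : ι → ℕ) (i : ι) : δ i ≤ strahler δ :=
  (strahler_le_iff.1 le_rfl).1 i

theorem strahler_le_of_forall_ne_lt {δ : ι → ℕ} {D : ℕ} (j : ι) (hj : δ j ≤ D)
    (h : ∀ i ≠ j, δ i < D) : strahler δ ≤ D := by
  have eq_j : ∀ {i}, δ i = D → i = j := fun hi => by_contra fun hij => (h _ hij).ne hi
  refine strahler_le_iff.2 ⟨fun i => ?_, fun i hi i' hi' => (eq_j hi).trans (eq_j hi').symm⟩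
  rcases eq_or_ne i j with rfl | hij
  exacts [hj, (h i hij).le]

theorem exists_ne_of_lt_strahler {δ : ι → ℕ} {D : ℕ} (hD : ∀ i, δ i ≤ D) (h : D < strahler δ) :
    ∃ i j, i ≠ j ∧ δ i = D ∧ δ j = D := by
  have hnt : {i | δ i = D}.Nontrivial :=
    Set.not_subsingleton_iff.1 fun hs => h.not_ge (strahler_le_iff.2 ⟨hD, hs⟩)
  obtain ⟨i, hi, j, hj, hij⟩ := hnt
  exact ⟨i, j, hij, hi, hj⟩

theorem strahler_eq_iff {δ : ι → ℕ} {e : ℕ} :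
    strahler δ = e ↔ (IsEmpty ι ∧ e = 0) ∨ (∃ j, δ j = e ∧ ∀ i ≠ j, δ i < e) ∨
      ((∀ i, δ i < e) ∧ {i | δ i + 1 = e}.Nontrivial) := by
  constructor
  · rintro rfl
    rcases isEmpty_or_nonempty ι with hι | ⟨⟨i₀⟩⟩
    · exact .inl ⟨hι, Nat.le_zero.1 <|
          strahler_le_iff.2 ⟨isEmptyElim, Set.subsingleton_of_subsingleton⟩⟩
    obtain ⟨-, hs⟩ := strahler_le_iff.1 (le_refl (strahler δ))
    by_cases hj : ∃ j, δ j = strahler δ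
    · obtain ⟨j, hj⟩ := hj
      exact .inr (.inl ⟨j, hj, fun i hij => (le_strahler δ i).lt_of_ne fun hi => hij (hs hi hj)⟩)
    · push Not at hj
      have hlt : ∀ i, δ i < strahler δ := fun i => (le_strahler δ i).lt_of_ne (hj i)
      have hpos := hlt i₀
      obtain ⟨i, j, hij, hi, hj⟩ := exists_ne_of_lt_strahler (δ := δ) (D := strahler δ - 1)
        (fun i => Nat.le_sub_one_of_lt (hlt i)) (by omega)
      refine .inr (.inr ⟨hlt, i, ?_, j, ?_, hij⟩) <;> simp only [Set.mem_ofPred_eq] <;> omega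
  · rintro (⟨hι, rfl⟩ | ⟨j, rfl, hlt⟩ | ⟨hlt, i, hi, j, hj, hij⟩)
    · exact Nat.le_zero.1 (strahler_le_iff.2 ⟨isEmptyElim, Set.subsingleton_of_subsingleton⟩)
    · exact (strahler_le_of_forall_ne_lt j le_rfl hlt).antisymm (le_strahler δ j)
    · simp only [Set.mem_ofPred_eq] at hi hj
      refine le_antisymm (strahler_le_iff.2 ⟨fun l => (hlt l).le, fun l hl => ?_⟩) ?_
      · exact absurd hl (hlt l).ne
      · by_contra! hlt'
        have := le_strahler δ i
        obtain ⟨-, hs⟩ := strahler_le_iff.1 (le_refl (strahler δ))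
        refine hij (hs ?_ ?_) <;> simp only [Set.mem_ofPred_eq] <;> omega

end Strahler

/-! ### Derivation trees with prescribed rules -/

section Inputs

variable {T N : Type*} {m m' : Multiset (ContextFreeRule T N)}

open Classical in
/-- The set of variables that are rewritten by a multiset of rules. -/
def inputs (m : Multiset (ContextFreeRule T N)) : Finset N :=
  (m.map ContextFreeRule.input).toFinset

theorem mem_inputs {Y : N} : Y ∈ inputs m ↔ ∃ r ∈ m, r.input = Y := by
  simp [inputs]

theorem inputs_mono (h : m ≤ m') : inputs m ⊆ inputs m' := fun _ hY =>
  have ⟨r, hr, hrY⟩ := mem_inputs.1 hY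
  mem_inputs.2 ⟨r, Multiset.mem_of_le h hr, hrY⟩

end Inputs

namespace DerivTree

variable {T : Type*} {G : ContextFreeGrammar T}

/-- The multiset of the rules at the nodes of a derivation tree. -/
def rules : {X : G.NT} → DerivTree G X → Multiset (ContextFreeRule T G.NT)
  | _, .node r _ f => {r} + ∑ i, (f i).rules

/-- The dimension (Strahler number) of a derivation tree. -/
def dim : {X : G.NT} → DerivTree G X → ℕ
  | _, .node _ _ f => strahler fun i => (f i).dim

theorem rules_le_sum {ι : Type*} [Fintype ι] {X : ι → G.NT} (f : ∀ l, DerivTree G (X l)) (l : ι) :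
    (f l).rules ≤ ∑ l, (f l).rules :=
  Finset.single_le_sum (f := fun l => (f l).rules) (fun _ _ => zero_le) (Finset.mem_univ l)

section Node

variable {r : ContextFreeRule T G.NT} {hr : r ∈ G.rules}
  {f : ∀ i : Fin (varsOf r.output).length, DerivTree G ((varsOf r.output).get i)}

theorem rules_node : (node r hr f).rules = {r} + ∑ i, (f i).rules := rfl

theorem dim_node : (node r hr f).dim = strahler fun i => (f i).dim := rfl

theorem sum_rules_lt_rules_node : ∑ i, (f i).rules < (node r hr f).rules :=
  lt_add_of_pos_left _ (Multiset.singleton_ne_zero r).bot_lt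

theorem child_rules_lt_rules_node (i) : (f i).rules < (node r hr f).rules :=
  (rules_le_sum f i).trans_lt sum_rules_lt_rules_node

theorem rules_node_update [DecidableEq (Fin (varsOf r.output).length)] (i) (u) :
    (node r hr (Function.update f i u)).rules =
      u.rules + ({r} + ∑ l ∈ Finset.univ.erase i, (f l).rules) := by
  have hrest : ∀ l ∈ Finset.univ.erase i, (Function.update f i u l).rules = (f l).rules :=
    fun l hl => by rw [Function.update_of_ne (Finset.ne_of_mem_erase hl)]
  rw [rules_node, ← Finset.add_sum_erase _ _ (Finset.mem_univ i), Function.update_self,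
    Finset.sum_congr rfl hrest, add_left_comm]

theorem rules_node_eq_child_add (i) :
    (node r hr f).rules = (f i).rules + ({r} + ∑ l ∈ Finset.univ.erase i, (f l).rules) := by
  rw [← rules_node_update, Function.update_eq_self]

theorem mem_inputs_rules_node {Y : G.NT} :
    Y ∈ inputs (node r hr f).rules ↔ Y = r.input ∨ ∃ i, Y ∈ inputs (f i).rules := by
  simp only [mem_inputs, rules_node, Multiset.mem_add, Multiset.mem_singleton,
    Multiset.mem_sum, Finset.mem_univ, true_and]
  constructor
  · rintro ⟨s, rfl | ⟨i, hi⟩, rfl⟩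
    exacts [.inl rfl, .inr ⟨i, s, hi, rfl⟩]
  · rintro (rfl | ⟨i, s, hi, rfl⟩)
    exacts [⟨r, .inl rfl, rfl⟩, ⟨s, .inr ⟨i, hi⟩, rfl⟩]

end Node

/-- `ε` is the multiset of rules of a context: an `X`-tree with one `Y`-subtree left open, which
can be filled with any `Y`-tree. -/
def HasContext (G : ContextFreeGrammar T) (X Y : G.NT)
    (ε : Multiset (ContextFreeRule T G.NT)) : Prop :=
  ∀ s : DerivTree G Y, ∃ t : DerivTree G X, t.rules = s.rules + ε

theorem HasContext.trans {X Y Z : G.NT} {ε ε' : Multiset (ContextFreeRule T G.NT)}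
    (h : HasContext G X Y ε) (h' : HasContext G Y Z ε') : HasContext G X Z (ε' + ε) := fun s =>
  have ⟨s', hs'⟩ := h' s
  have ⟨t, ht⟩ := h s'
  ⟨t, by rw [ht, hs', add_assoc]⟩

theorem hasContext_node {r : ContextFreeRule T G.NT} (hr : r ∈ G.rules)
    (f : ∀ i : Fin (varsOf r.output).length, DerivTree G ((varsOf r.output).get i)) (i) :
    HasContext G r.input ((varsOf r.output).get i)
      ({r} + ∑ l ∈ Finset.univ.erase i, (f l).rules) := fun s =>
  ⟨node r hr (Function.update f i s), rules_node_update i s⟩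

theorem exists_subtree {X Y : G.NT} (t : DerivTree G X) (hY : Y ∈ inputs t.rules) :
    ∃ (s : DerivTree G Y) (ε : Multiset (ContextFreeRule T G.NT)),
      t.rules = s.rules + ε ∧ HasContext G X Y ε := by
  induction t with
  | node r hr f ih =>
    rcases mem_inputs_rules_node.1 hY with rfl | ⟨i, hi⟩
    · exact ⟨node r hr f, 0, (add_zero _).symm, fun s => ⟨s, (add_zero _).symm⟩⟩
    · obtain ⟨s, ε, hs, hε⟩ := ih i hi
      refine ⟨s, _, ?_, (hasContext_node hr f i).trans hε⟩
      rw [rules_node_eq_child_add i, hs, add_assoc]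

theorem HasContext.exists_insert {X Y : G.NT} {δ : Multiset (ContextFreeRule T G.NT)}
    (hδ : HasContext G Y Y δ) (t : DerivTree G X) (hY : Y ∈ inputs t.rules) :
    ∃ t' : DerivTree G X, t'.rules = t.rules + δ := by
  obtain ⟨s, ε, hs, hε⟩ := t.exists_subtree hY
  obtain ⟨t', ht'⟩ := (hε.trans hδ) s
  exact ⟨t', by rw [ht', hs]; abel⟩

theorem dim_node_lt_card_inputs {r : ContextFreeRule T G.NT} {hr : r ∈ G.rules}
    {f : ∀ i : Fin (varsOf r.output).length, DerivTree G ((varsOf r.output).get i)}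
    (hf : ∀ i, (f i).dim < (inputs (f i).rules).card)
    (hr' : ∀ i, r.input ∉ inputs (f i).rules) :
    (node r hr f).dim < (inputs (node r hr f).rules).card := by
  have hmem : r.input ∈ inputs (node r hr f).rules := mem_inputs_rules_node.2 (.inl rfl)
  have hlt : ∀ i, (f i).dim + 1 < (inputs (node r hr f).rules).card := fun i =>
    (Nat.succ_le_of_lt (hf i)).trans_lt <| Finset.card_lt_card <|
      (Finset.ssubset_iff_of_subset (inputs_mono (child_rules_lt_rules_node i).le)).2
        ⟨r.input, hmem, hr' i⟩
  have hpos : 0 < (inputs (node r hr f).rules).card := Finset.card_pos.2 ⟨_, hmem⟩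
  refine Nat.lt_of_le_pred hpos (strahler_le_iff.2 ⟨fun i => ?_, fun i hi => ?_⟩)
  · exact Nat.le_pred_of_lt (Nat.lt_of_succ_lt (hlt i))
  · simp only [Set.mem_ofPred_eq, Nat.pred_eq_sub_one] at hi
    have := hlt i
    omega

theorem exists_pump {X : G.NT} (t : DerivTree G X) (ht : (inputs t.rules).card ≤ t.dim) :
    ∃ (Y : G.NT) (δ : Multiset (ContextFreeRule T G.NT)) (t' : DerivTree G X),
      δ ≠ 0 ∧ Y ∈ inputs t.rules ∧ t.rules = t'.rules + δ ∧ HasContext G Y Y δ := by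
  induction t with
  | node r hr f ih =>
    by_cases hf : ∃ i, (inputs (f i).rules).card ≤ (f i).dim
    · obtain ⟨i, hi⟩ := hf
      obtain ⟨Y, δ, s, hδ, hY, hs, hYδ⟩ := ih i hi
      refine ⟨Y, δ, node r hr (Function.update f i s), hδ,
        inputs_mono (child_rules_lt_rules_node i).le hY, ?_, hYδ⟩
      rw [rules_node_eq_child_add i, rules_node_update, hs]
      abel
    by_cases hX : ∃ i, r.input ∈ inputs (f i).rules
    · obtain ⟨i, hi⟩ := hX
      obtain ⟨s, ε, hs, hε⟩ := (f i).exists_subtree hi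
      refine ⟨r.input, _, s, ?_, mem_inputs_rules_node.2 (.inl rfl), ?_,
        (hasContext_node hr f i).trans hε⟩
      · simp
      · rw [rules_node_eq_child_add i, hs, add_assoc]
    · push Not at hf hX
      exact absurd ht (dim_node_lt_card_inputs hf hX).not_ge

/-! ### Compact trees -/

section Shift

variable {ι : Type*} [Fintype ι] {X : ι → G.NT} {f g : ∀ l, DerivTree G (X l)} {j : ι}

/-- The family of trees `g` arises from `f` by moving rules from the other trees to the tree with
index `j`. -/
structure Shift (j : ι) (f g : ∀ l, DerivTree G (X l)) : Prop where
  sum_eq : ∑ l, (g l).rules = ∑ l, (f l).rules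
  le : ∀ l ≠ j, (g l).rules ≤ (f l).rules

theorem Shift.trans {h : ∀ l, DerivTree G (X l)} (hfg : Shift j f g) (hgh : Shift j g h) :
    Shift j f h :=
  ⟨hgh.sum_eq.trans hfg.sum_eq, fun l hl => (hgh.le l hl).trans (hfg.le l hl)⟩

theorem Shift.of_rules_eq (h : ∀ l, (g l).rules = (f l).rules) : Shift j f g :=
  ⟨Finset.sum_congr rfl fun l _ => h l, fun l _ => (h l).le⟩

theorem Shift.rules_le (h : Shift j f g) : (f j).rules ≤ (g j).rules := by
  classical
  have hrest : ∑ l ∈ Finset.univ.erase j, (g l).rules ≤ ∑ l ∈ Finset.univ.erase j, (f l).rules :=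
    Finset.sum_le_sum fun l hl => h.le l (Finset.ne_of_mem_erase hl)
  have hsum := h.sum_eq
  rw [← Finset.add_sum_erase _ _ (Finset.mem_univ j),
    ← Finset.add_sum_erase _ (fun l => (f l).rules) (Finset.mem_univ j)] at hsum
  exact le_of_add_le_add_right (hsum.symm.le.trans (add_le_add_right hrest _))

theorem exists_shift_lt {i : ι} (hij : i ≠ j)
    (hj : inputs (∑ l, (f l).rules) ⊆ inputs (f j).rules)
    (hi : (inputs (∑ l, (f l).rules)).card ≤ (f i).dim) :
    ∃ g, Shift j f g ∧ (f j).rules < (g j).rules := by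
  classical
  have hsub := inputs_mono (rules_le_sum f i)
  obtain ⟨Y, δ, u, hδ, hY, hu, hYδ⟩ := (f i).exists_pump ((Finset.card_le_card hsub).trans hi)
  obtain ⟨w, hw⟩ := hYδ.exists_insert (f j) (hj (hsub hY))
  let g := Function.update (Function.update f i u) j w
  have hgj : g j = w := Function.update_self ..
  have hgi : g i = u := by rw [show g i = _ from Function.update_of_ne hij .., Function.update_self]
  have hg : ∀ l, l ≠ j → l ≠ i → g l = f l := fun l hlj hli => by
    rw [show g l = _ from Function.update_of_ne hlj .., Function.update_of_ne hli]
  refine ⟨g, ⟨?_, fun l hlj => ?_⟩, ?_⟩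
  · have hi' : i ∈ Finset.univ.erase j := Finset.mem_erase.2 ⟨hij, Finset.mem_univ i⟩
    have hrest : ∀ l ∈ (Finset.univ.erase j).erase i, (g l).rules = (f l).rules := fun l hl => by
      simp only [Finset.mem_erase, Finset.mem_univ, and_true] at hl
      rw [hg l hl.2 hl.1]
    simp only [← Finset.add_sum_erase _ _ (Finset.mem_univ j), ← Finset.add_sum_erase _ _ hi',
      Finset.sum_congr rfl hrest, hgj, hgi, hw, hu]
    abel
  · rcases eq_or_ne l i with rfl | hli
    · rw [hgi, hu]
      exact Multiset.le_add_right _ _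
    · rw [hg l hlj hli]
  · rw [hgj, hw]
    exact lt_add_of_pos_right _ (pos_iff_ne_zero.2 hδ)

/-- The trees with the same rules as `t` and of dimension at most `D`. -/
def variants {X : G.NT} (t : DerivTree G X) (D : ℕ) : Set (DerivTree G X) :=
  {t' | t'.rules = t.rules ∧ t'.dim ≤ D}

/-- The compact trees with the same rules as `t`: a tree is compact if its dimension is at most the
number of variables rewritten in it. -/
def compactVariants {X : G.NT} (t : DerivTree G X) : Set (DerivTree G X) :=
  t.variants (inputs t.rules).card

theorem compactVariants_congr {X : G.NT} {t t' : DerivTree G X} (h : t'.rules = t.rules) :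
    t'.compactVariants = t.compactVariants := by
  rw [compactVariants, compactVariants, variants, variants, h]

theorem exists_shift_strahler_le
    (hcomp : ∀ (Y : G.NT) (s : DerivTree G Y), s.rules ≤ ∑ l, (f l).rules →
      s.compactVariants.Nonempty)
    (hj : inputs (∑ l, (f l).rules) ⊆ inputs (f j).rules) :
    ∃ g, Shift j f g ∧ strahler (fun l => (g l).dim) ≤ (inputs (∑ l, (f l).rules)).card := by
  classical
  -- A family with as few rules as possible outside of `j` admits no further move.
  obtain ⟨g, hfg, hmin⟩ := exists_minimalFor_of_wellFoundedLT (Shift j f)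
    (fun g => ∑ l ∈ Finset.univ.erase j, (g l).rules) ⟨f, .of_rules_eq fun _ => rfl⟩
  choose h hh using fun l => hcomp _ (g l) ((rules_le_sum g l).trans hfg.sum_eq.le)
  have hfh : Shift j f h := hfg.trans (.of_rules_eq fun l => (hh l).1)
  have hdim : ∀ l, (h l).dim ≤ (inputs (∑ l, (f l).rules)).card := fun l =>
    (hh l).2.trans <| Finset.card_le_card <| inputs_mono <|
      (rules_le_sum g l).trans hfg.sum_eq.le
  refine ⟨h, hfh, strahler_le_of_forall_ne_lt j (hdim j) fun i hij => ?_⟩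
  by_contra! hi
  rw [← hfh.sum_eq] at hi hj
  obtain ⟨h', hhh', hlt⟩ := exists_shift_lt hij (hj.trans (inputs_mono hfh.rules_le)) hi
  have hle := hmin (hfh.trans hhh') <| Finset.sum_le_sum fun l hl =>
    (hhh'.le l (Finset.ne_of_mem_erase hl)).trans (hh l).1.le
  have hsum := hhh'.sum_eq.trans (Finset.sum_congr rfl fun l _ => (hh l).1)
  rw [← Finset.add_sum_erase _ _ (Finset.mem_univ j),
    ← Finset.add_sum_erase _ (fun l => (g l).rules) (Finset.mem_univ j), ← (hh j).1] at hsum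
  exact (add_lt_add_of_lt_of_le hlt hle).ne' hsum

end Shift

section Compact

variable {r : ContextFreeRule T G.NT} {hr : r ∈ G.rules}
  {f : ∀ i : Fin (varsOf r.output).length, DerivTree G ((varsOf r.output).get i)}

theorem nontrivial_compactVariants_of_children
    (hcomp : ∀ (Y : G.NT) (s : DerivTree G Y), s.rules < (node r hr f).rules →
      s.compactVariants.Nonempty)
    (hf : ∀ i, (f i).dim ≤ (inputs (f i).rules).card)
    (hdim : (inputs (node r hr f).rules).card < (node r hr f).dim) :
    (node r hr f).compactVariants.Nontrivial := by
  set I := inputs (node r hr f).rules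
  have hsub : ∀ i, inputs (f i).rules ⊆ I := fun i =>
    inputs_mono (child_rules_lt_rules_node i).le
  have hsum : inputs (∑ l, (f l).rules) ⊆ I := inputs_mono sum_rules_lt_rules_node.le
  have transfer : ∀ i j, i ≠ j → (f i).dim = I.card → (f j).dim = I.card →
      ∃ g, node r hr g ∈ (node r hr f).compactVariants ∧
        (g i).rules ≤ (f i).rules ∧ (f j).rules < (g j).rules := by
    intro i j hij hi hj
    have hjI : inputs (f j).rules = I := Finset.eq_of_subset_of_card_le (hsub j) (hj ▸ hf j)
    obtain ⟨g, hfg, hlt⟩ := exists_shift_lt hij (hsum.trans hjI.ge)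
      ((Finset.card_le_card hsum).trans hi.ge)
    obtain ⟨h, hgh, hdim⟩ := exists_shift_strahler_le (f := g) (j := j)
      (fun Y s hs => hcomp Y s ((hs.trans hfg.sum_eq.le).trans_lt sum_rules_lt_rules_node))
      (by rw [hfg.sum_eq]; exact (hsum.trans hjI.ge).trans (inputs_mono hfg.rules_le))
    have hfh := hfg.trans hgh
    refine ⟨h, ⟨?_, hdim.trans (Finset.card_le_card ?_)⟩, hfh.le i hij, hlt.trans_le hgh.rules_le⟩
    · rw [rules_node, rules_node, hfh.sum_eq]
    · rw [hfg.sum_eq]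
      exact hsum
  obtain ⟨i, j, hij, hi, hj⟩ := exists_ne_of_lt_strahler
    (fun i => (hf i).trans (Finset.card_le_card (hsub i))) hdim
  obtain ⟨g₁, hg₁, -, hlt⟩ := transfer i j hij hi hj
  obtain ⟨g₂, hg₂, hle, -⟩ := transfer j i hij.symm hj hi
  refine ⟨_, hg₁, _, hg₂, fun h => ?_⟩
  obtain rfl : g₁ = g₂ := by simpa using h
  exact (hlt.trans_le hle).false

theorem nontrivial_compactVariants {X : G.NT} (t : DerivTree G X)
    (ht : (inputs t.rules).card < t.dim) : t.compactVariants.Nontrivial := by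
  induction hm : t.rules using WellFoundedLT.induction generalizing X t with
  | _ m ih =>
    subst hm
    have hcomp : ∀ (Y : G.NT) (s : DerivTree G Y), s.rules < t.rules →
        s.compactVariants.Nonempty := fun Y s hs => by
      by_cases hdim : s.dim ≤ (inputs s.rules).card
      exacts [⟨s, rfl, hdim⟩, (ih _ hs s (not_le.1 hdim) rfl).nonempty]
    cases t with
    | node r hr f =>
    have rules_eq : ∀ g ∈ Set.univ.pi fun i => (f i).compactVariants,
        (node r hr g).rules = (node r hr f).rules := fun g hg => by
      simp only [rules_node, (hg _ trivial).1]
    by_cases h : ∃ g ∈ Set.univ.pi fun i => (f i).compactVariants,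
        (inputs (node r hr f).rules).card < (node r hr g).dim
    · obtain ⟨g, hg, hdim⟩ := h
      have hr' := rules_eq g hg
      rw [← compactVariants_congr hr']
      rw [← hr'] at hdim hcomp
      exact nontrivial_compactVariants_of_children hcomp
        (fun i => (hg i trivial).1 ▸ (hg i trivial).2) hdim
    · push Not at h
      obtain ⟨i, hi⟩ : ∃ i, (inputs (f i).rules).card < (f i).dim := by
        by_contra! hf
        exact (h f fun i _ => ⟨rfl, hf i⟩).not_gt ht
      obtain ⟨u₁, hu₁, u₂, hu₂, hne⟩ := ih _ (child_rules_lt_rules_node i) (f i) hi rfl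
      choose g hg using fun i => hcomp _ (f i) (child_rules_lt_rules_node i)
      have mem : ∀ u ∈ (f i).compactVariants,
          node r hr (Function.update g i u) ∈ (node r hr f).compactVariants := fun u hu => by
        have hpi : Function.update g i u ∈ Set.univ.pi fun i => (f i).compactVariants := by
          intro l _
          rcases eq_or_ne l i with rfl | hl
          · rwa [Function.update_self]
          · rw [Function.update_of_ne hl]
            exact hg l
        exact ⟨rules_eq _ hpi, h _ hpi⟩
      refine ⟨_, mem u₁ hu₁, _, mem u₂ hu₂, fun heq => hne ?_⟩
      exact Function.update_injective g i (by simpa using heq)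

theorem nonempty_compactVariants {X : G.NT} (t : DerivTree G X) : t.compactVariants.Nonempty := by
  by_cases h : t.dim ≤ (inputs t.rules).card
  exacts [⟨t, rfl, h⟩, (t.nontrivial_compactVariants (not_le.1 h)).nonempty]

end Compact

/-! ### Many variants of small dimension -/

section Variants

variable {r : ContextFreeRule T G.NT} {hr : r ∈ G.rules}
  {f : ∀ i : Fin (varsOf r.output).length, DerivTree G ((varsOf r.output).get i)}

theorem prod_encard_variants_le {D' : Fin (varsOf r.output).length → ℕ} {D : ℕ}
    (h : strahler D' ≤ D) :
    ∏ i, ((f i).variants (D' i)).encard ≤ ((node r hr f).variants D).encard := by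
  rw [← Set.encard_pi_eq_prod_encard]
  refine Set.encard_le_encard_of_injOn (f := node r hr) (fun g hg => ⟨?_, ?_⟩)
    fun g _ g' _ hgg' => by simpa using hgg'
  · simp only [rules_node, (hg _ trivial).1]
  · obtain ⟨hle, hs⟩ := strahler_le_iff.1 h
    have hdim : ∀ i, (g i).dim ≤ D' i := fun i => (hg i trivial).2
    exact strahler_le_iff.2 ⟨fun i => (hdim i).trans (hle i),
      hs.anti fun i hi => (hle i).antisymm (hi.symm.le.trans (hdim i))⟩

theorem variants_nonempty [Fintype G.NT] {X : G.NT} (t : DerivTree G X) {D : ℕ}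
    (hD : Fintype.card G.NT ≤ D) : (t.variants D).Nonempty :=
  have ⟨t', hrules, hdim⟩ := t.nonempty_compactVariants
  ⟨t', hrules, hdim.trans ((Finset.card_le_univ _).trans hD)⟩

theorem prod_encard_variants_subset_le [Fintype G.NT] {D' : Fin (varsOf r.output).length → ℕ}
    {D : ℕ} (h : strahler D' ≤ D) (s : Finset (Fin (varsOf r.output).length))
    (hD' : ∀ i, Fintype.card G.NT ≤ D' i) :
    ∏ i ∈ s, ((f i).variants (D' i)).encard ≤ ((node r hr f).variants D).encard :=
  (Finset.prod_le_prod_of_subset_of_one_le' (Finset.subset_univ s) fun i _ _ =>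
    Set.one_le_encard_iff_nonempty.2 ((f i).variants_nonempty (hD' i))).trans
      (prod_encard_variants_le h)

theorem two_pow_two_pow_le_encard_variants [Fintype G.NT] (k : ℕ) {X : G.NT} (t : DerivTree G X)
    (ht : Fintype.card G.NT + k < t.dim) :
    2 ^ 2 ^ k ≤ (t.variants (Fintype.card G.NT + k)).encard := by
  induction k generalizing X t with
  | zero =>
    have hcard : (inputs t.rules).card ≤ Fintype.card G.NT := Finset.card_le_univ _
    have hnt : (t.variants (Fintype.card G.NT)).Nontrivial :=
      (t.nontrivial_compactVariants (by omega)).mono fun t' ht' => ⟨ht'.1, ht'.2.trans hcard⟩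
    simpa [← one_add_one_eq_two] using
      Order.add_one_le_of_lt (Set.one_lt_encard_iff_nontrivial.2 hnt)
  | succ k ihk =>
    induction t with
    | node r hr f ih =>
      by_cases h : ∃ i, Fintype.card G.NT + (k + 1) < (f i).dim
      · obtain ⟨i, hi⟩ := h
        let D' : Fin (varsOf r.output).length → ℕ :=
          Function.update (fun _ => Fintype.card G.NT) i (Fintype.card G.NT + (k + 1))
        have hD' : strahler D' ≤ Fintype.card G.NT + (k + 1) :=
          strahler_le_of_forall_ne_lt i (by simp [D']) fun l hl => by simp [D', hl]
        have hcard : ∀ l, Fintype.card G.NT ≤ D' l :=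
          fun l => by rcases eq_or_ne l i with rfl | hl <;> simp [D', *]
        refine (ih i hi).trans (le_of_eq_of_le ?_ (prod_encard_variants_subset_le hD' {i} hcard))
        simp [D']
      · push Not at h
        obtain ⟨i, j, hij, hi, hj⟩ := exists_ne_of_lt_strahler h ht
        calc (2 : ℕ∞) ^ 2 ^ (k + 1) = 2 ^ 2 ^ k * 2 ^ 2 ^ k := by rw [pow_succ 2 k, pow_mul, sq]
          _ ≤ ∏ l ∈ {i, j}, ((f l).variants (Fintype.card G.NT + k)).encard := by
            rw [Finset.prod_pair hij]
            exact mul_le_mul' (ihk (f i) (by omega)) (ihk (f j) (by omega))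
          _ ≤ _ := prod_encard_variants_subset_le
            (strahler_le_of_forall_ne_lt i (by omega) fun _ _ => by omega) _ fun _ => by omega

end Variants

end DerivTree

/-! ### Generating series of weighted sets -/

/-- The generating series of a set `A` of objects with weights in `ℕ^T`: its coefficient at `v` is
the number of elements of `A` of weight `v`. -/
def weightSeries {T α : Type*} (w : α → T →₀ ℕ) (A : Set α) : MvPowerSeries T ℕ∞ :=
  fun v => {a ∈ A | w a = v}.encard

section weightSeries

variable {T α β : Type*}

theorem coeff_weightSeries (w : α → T →₀ ℕ) (A : Set α) (v : T →₀ ℕ) :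
    MvPowerSeries.coeff v (weightSeries w A) = {a ∈ A | w a = v}.encard := rfl

theorem encard_biUnion_finset {ι : Type*} (s : Finset ι) (A : ι → Set α)
    (hA : (s : Set ι).PairwiseDisjoint A) : (⋃ i ∈ s, A i).encard = ∑ i ∈ s, (A i).encard := by
  rw [← finsum_mem_coe_finset, ← s.finite_toSet.encard_biUnion hA]
  rfl

theorem weightSeries_biUnion {ι : Type*} (w : α → T →₀ ℕ) (s : Finset ι) (A : ι → Set α)
    (hA : (s : Set ι).PairwiseDisjoint A) :
    weightSeries w (⋃ i ∈ s, A i) = ∑ i ∈ s, weightSeries w (A i) := by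
  ext v
  simp only [map_sum, coeff_weightSeries]
  rw [← encard_biUnion_finset s (fun i => {a ∈ A i | w a = v})
    fun i hi j hj hij => (hA hi hj hij).mono (fun _ => And.left) fun _ => And.left]
  congr 1
  ext a
  simp only [Set.mem_iUnion, Set.mem_ofPred_eq]
  tauto

theorem weightSeries_image (w : α → T →₀ ℕ) {g : β → α} (hg : g.Injective) (A : Set β) :
    weightSeries w (g '' A) = weightSeries (w ∘ g) A := by
  ext v
  rw [coeff_weightSeries, coeff_weightSeries, ← hg.encard_image]
  congr 1
  ext a
  constructor
  · rintro ⟨⟨b, hb, rfl⟩, hv⟩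
    exact ⟨b, ⟨hb, hv⟩, rfl⟩
  · rintro ⟨b, ⟨hb, hv⟩, rfl⟩
    exact ⟨⟨b, hb, rfl⟩, hv⟩

theorem weightSeries_add_left (c : T →₀ ℕ) (w : α → T →₀ ℕ) (A : Set α) :
    weightSeries (fun a => c + w a) A = MvPowerSeries.monomial c 1 * weightSeries w A := by
  ext v
  rw [MvPowerSeries.coeff_monomial_mul, coeff_weightSeries, coeff_weightSeries, one_mul]
  split_ifs with hcv
  · congr 1
    ext a
    exact and_congr_right fun _ =>
      ⟨fun h => by rw [← h, add_tsub_cancel_left], fun h => by rw [h, add_tsub_cancel_of_le hcv]⟩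
  · rw [Set.encard_eq_zero, Set.eq_empty_iff_forall_notMem]
    rintro a ⟨-, rfl⟩
    exact hcv le_self_add

theorem weightSeries_pi {ι : Type*} [Fintype ι] {α : ι → Type*} (w : ∀ i, α i → T →₀ ℕ)
    (A : ∀ i, Set (α i)) :
    weightSeries (fun f : ∀ i, α i => ∑ i, w i (f i)) (Set.univ.pi A) =
      ∏ i, weightSeries (w i) (A i) := by
  classical
  ext v
  rw [MvPowerSeries.coeff_prod]
  simp only [coeff_weightSeries, ← Set.encard_pi_eq_prod_encard]
  rw [← encard_biUnion_finset]
  · congr 1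
    ext f
    simp only [Set.mem_ofPred_eq, Set.mem_univ_pi, Set.mem_iUnion, Finset.mem_finsuppAntidiag,
      exists_prop]
    constructor
    · rintro ⟨hf, hv⟩
      exact ⟨Finsupp.equivFunOnFinite.symm fun i => w i (f i), ⟨hv, Finset.subset_univ _⟩,
        fun i => ⟨hf i, rfl⟩⟩
    · rintro ⟨l, ⟨hv, -⟩, hf⟩
      exact ⟨fun i => (hf i).1, hv ▸ Finset.sum_congr rfl fun i _ => (hf i).2⟩
  · refine fun l _ l' _ hl => Set.disjoint_left.2 fun f hf hf' => hl ?_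
    ext1 i
    exact (hf i trivial).2.symm.trans (hf' i trivial).2

end weightSeries

/-! ### Root decomposition -/

section Parikh

variable {T N : Type*}

theorem parikhVector_append (u v : List T) :
    parikhVector (u ++ v) = parikhVector u + parikhVector v := by
  simp [parikhVector]

/-- The Parikh vector of the word `u₀ u₁ … u_r` formed by the letters of a sentential form
`u₀ X₁ u₁ … X_r u_r`. -/
def terminalParikh : List (Symbol T N) → T →₀ ℕ
  | [] => 0
  | Symbol.terminal a :: γ => Finsupp.single a 1 + terminalParikh γ
  | Symbol.nonterminal _ :: γ => terminalParikh γ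

theorem parikhVector_plugIn (γ : List (Symbol T N)) (w : Fin (varsOf γ).length → List T) :
    parikhVector (plugIn id γ w) = terminalParikh γ + ∑ i, parikhVector (w i) := by
  induction γ with
  | nil =>
    have h : ∑ i, parikhVector (w i) = 0 := Finset.sum_eq_zero fun i _ => Fin.elim0 i
    rw [h]
    rfl
  | cons s γ ih =>
    cases s with
    | terminal a =>
      have h : parikhVector [a] = Finsupp.single a 1 := by simp [parikhVector]
      have h' := parikhVector_append [a] (plugIn id γ w)
      rwa [ih w, h, ← add_assoc] at h'
    | nonterminal X =>
      have h : ∑ i, parikhVector (w i) =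
          parikhVector (w ⟨0, Nat.succ_pos _⟩) +
            ∑ i : Fin (varsOf γ).length, parikhVector (w i.succ) :=
        Fin.sum_univ_succ (n := (varsOf γ).length) fun i => parikhVector (w i)
      rw [plugIn, parikhVector_append, ih, h, terminalParikh]
      exact add_left_comm _ _ _

/-- The right-hand side for `X` in the polynomial system of a set `P` of rules whose variables are
refined by attributes in `Q`: the value `y Y q` belongs to the variable `Y` with the attribute `q`,
and `Δ r` is the set of admissible attributes of the children at a node with the rule `r`. -/
def attrPoly {Q R : Type*} [CommSemiring R] (P : Finset (ContextFreeRule T N)) (X : N)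
    (Δ : ∀ r : ContextFreeRule T N, Finset (Fin (varsOf r.output).length → Q))
    (y : N → Q → MvPowerSeries T R) : MvPowerSeries T R :=
  open Classical in
  ∑ r ∈ P with r.input = X, MvPowerSeries.monomial (terminalParikh r.output) 1 *
    ∑ δ ∈ Δ r, ∏ i, y ((varsOf r.output).get i) (δ i)

theorem map_attrPoly {Q R S : Type*} [CommSemiring R] [CommSemiring S] (φ : R →+* S)
    (P : Finset (ContextFreeRule T N)) (X : N)
    (Δ : ∀ r : ContextFreeRule T N, Finset (Fin (varsOf r.output).length → Q))
    (y : N → Q → MvPowerSeries T R) :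
    MvPowerSeries.map φ (attrPoly P X Δ y) =
      attrPoly P X Δ fun Y q => MvPowerSeries.map φ (y Y q) := by
  simp only [attrPoly, map_sum, map_mul, map_prod, MvPowerSeries.map_monomial, map_one]

end Parikh

namespace DerivTree

variable {T : Type*} {G : ContextFreeGrammar T} {X : G.NT}

/-- The Parikh vector of the yield of a derivation tree. -/
def parikh (t : DerivTree G X) : T →₀ ℕ := parikhVector t.yield

theorem parikh_node (r : ContextFreeRule T G.NT) (hr : r ∈ G.rules)
    (f : ∀ i : Fin (varsOf r.output).length, DerivTree G ((varsOf r.output).get i)) :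
    (node r hr f).parikh = terminalParikh r.output + ∑ i, (f i).parikh :=
  parikhVector_plugIn _ _

theorem parikh_eq_sum (t : DerivTree G X) :
    t.parikh = (t.rules.map fun r => terminalParikh r.output).sum := by
  induction t with
  | node r hr f ih =>
    let weight : Multiset (ContextFreeRule T G.NT) →+ T →₀ ℕ :=
      Multiset.sumAddMonoidHom.comp (Multiset.mapAddMonoidHom fun r => terminalParikh r.output)
    have h : weight (∑ i, (f i).rules) = ∑ i, weight (f i).rules := map_sum _ _ _
    rw [parikh_node, rules_node, Multiset.map_add, Multiset.sum_add, Multiset.map_singleton,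
      Multiset.sum_singleton, Finset.sum_congr rfl fun i _ => ih i]
    exact congrArg _ h.symm

/-- The rule at the root of a derivation tree. -/
def rootRule : {X : G.NT} → DerivTree G X → ContextFreeRule T G.NT
  | _, node r _ _ => r

theorem rootRule_mem (t : DerivTree G X) : t.rootRule ∈ G.rules := by
  cases t
  assumption

theorem rootRule_input (t : DerivTree G X) : t.rootRule.input = X := by
  cases t
  rfl

theorem exists_eq_cast_node (t : DerivTree G X) (r : ContextFreeRule T G.NT) (hr : r ∈ G.rules)
    (h : r.input = X) (hroot : t.rootRule = r) : ∃ f, t = h ▸ node r hr f := by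
  cases t with
  | node s hs f =>
    cases hroot
    exact ⟨f, rfl⟩

theorem node_injective (r : ContextFreeRule T G.NT) (hr : r ∈ G.rules) :
    Function.Injective (node r hr) := fun f g h => by simpa using h

theorem weightSeries_node_image_pi (r : ContextFreeRule T G.NT) (hr : r ∈ G.rules)
    (B : ∀ i : Fin (varsOf r.output).length, Set (DerivTree G ((varsOf r.output).get i))) :
    weightSeries parikh (node r hr '' Set.univ.pi B) =
      MvPowerSeries.monomial (terminalParikh r.output) 1 * ∏ i, weightSeries parikh (B i) := by
  rw [weightSeries_image _ (node_injective r hr), ← weightSeries_pi, ← weightSeries_add_left]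
  exact congrArg (weightSeries · _) (funext (parikh_node r hr))

open Classical in
theorem weightSeries_eq_sum_rootRule (A : Set (DerivTree G X)) :
    weightSeries parikh A =
      ∑ r ∈ G.rules with r.input = X, weightSeries parikh {t ∈ A | t.rootRule = r} := by
  rw [← weightSeries_biUnion]
  · congr 1
    ext t
    simp only [Set.mem_iUnion, Set.mem_ofPred_eq, Finset.mem_filter, exists_prop]
    exact ⟨fun ht => ⟨_, ⟨t.rootRule_mem, t.rootRule_input⟩, ht, rfl⟩, fun ⟨_, _, ht, _⟩ => ht⟩
  · exact fun r _ s _ hrs => Set.disjoint_left.2 fun t ht ht' => hrs (ht.2.symm.trans ht'.2)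

variable {Q : Type*} (c : ∀ {X : G.NT}, DerivTree G X → Q)

theorem setOf_rootRule_eq_biUnion (r : ContextFreeRule T G.NT) (hr : r ∈ G.rules)
    (Δ : Finset (Fin (varsOf r.output).length → Q)) (A : Set (DerivTree G r.input))
    (B : ∀ X, Set (DerivTree G X))
    (hA : ∀ f, node r hr f ∈ A ↔ (fun i => c (f i)) ∈ Δ ∧ ∀ i, f i ∈ B _) :
    {t ∈ A | t.rootRule = r} =
      ⋃ δ ∈ Δ, node r hr '' Set.univ.pi fun i => {t ∈ B _ | c t = δ i} := by
  ext t
  simp only [Set.mem_iUnion, Set.mem_ofPred_eq, exists_prop, Set.mem_image, Set.mem_univ_pi]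
  constructor
  · rintro ⟨ht, hroot⟩
    obtain ⟨f, rfl⟩ := t.exists_eq_cast_node r hr rfl hroot
    obtain ⟨hδ, hf⟩ := (hA f).1 ht
    exact ⟨_, hδ, f, fun i => ⟨hf i, rfl⟩, rfl⟩
  · rintro ⟨δ, hδ, f, hf, rfl⟩
    obtain rfl : (fun i => c (f i)) = δ := funext fun i => (hf i).2
    exact ⟨(hA f).2 ⟨hδ, fun i => (hf i).1⟩, rfl⟩

theorem weightSeries_eq_attrPoly
    (Δ : ∀ r : ContextFreeRule T G.NT, Finset (Fin (varsOf r.output).length → Q))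
    (A B : ∀ X, Set (DerivTree G X))
    (hA : ∀ r hr f, node r hr f ∈ A r.input ↔
      (fun i => c (f i)) ∈ Δ r ∧ ∀ i, f i ∈ B _) (X : G.NT) :
    weightSeries parikh (A X) =
      attrPoly G.rules X Δ fun Y q => weightSeries parikh {t ∈ B Y | c t = q} := by
  classical
  rw [weightSeries_eq_sum_rootRule]
  refine Finset.sum_congr rfl fun r hmem => ?_
  obtain ⟨hr, rfl⟩ := Finset.mem_filter.1 hmem
  rw [setOf_rootRule_eq_biUnion c r hr (Δ r) (A _) B (hA r hr), weightSeries_biUnion,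
    Finset.mul_sum]
  · exact Finset.sum_congr rfl fun δ _ => weightSeries_node_image_pi r hr _
  · refine fun δ _ δ' _ hδ => (Set.disjoint_image_iff (node_injective r hr)).2 ?_
    refine Set.disjoint_left.2 fun f hf hf' => hδ (funext fun i => ?_)
    exact (hf i trivial).2.symm.trans (hf' i trivial).2

/-- The height of a derivation tree. -/
def height : {X : G.NT} → DerivTree G X → ℕ
  | _, node _ _ t => (Finset.univ.sup fun i => (t i).height) + 1

end DerivTree

/-! ### The order on power series -/

theorem naturalLE_iff_le {S : Type*} [Semiring S] [PartialOrder S] [CanonicallyOrderedAdd S]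
    {a b : S} : NaturalLE a b ↔ a ≤ b :=
  ⟨fun ⟨_, h⟩ => h ▸ le_self_add, fun h => (le_iff_exists_add.1 h).imp fun _ => Eq.symm⟩

section SeriesOrder

variable {σ R : Type*} [CommSemiring R] [PartialOrder R]

instance instPartialOrderSeries : PartialOrder (MvPowerSeries σ R) :=
  inferInstanceAs (PartialOrder ((σ →₀ ℕ) → R))

instance instCanonicallyOrderedAddSeries [CanonicallyOrderedAdd R] :
    CanonicallyOrderedAdd (MvPowerSeries σ R) :=
  inferInstanceAs (CanonicallyOrderedAdd ((σ →₀ ℕ) → R))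

end SeriesOrder

namespace CollapsedNat

variable {k : ℕ}

theorem val_ofNat (n : ℕ) : (ofNat k n).1 = min n k := rfl

theorem val_add (a b : CollapsedNat k) : (a + b).1 = min (a.1 + b.1) k := rfl

instance : PartialOrder (CollapsedNat k) := inferInstanceAs (PartialOrder {n : ℕ // n ≤ k})

theorem le_iff_val_le {a b : CollapsedNat k} : a ≤ b ↔ a.1 ≤ b.1 := Iff.rfl

instance : CanonicallyOrderedAdd (CollapsedNat k) where
  exists_add_of_le {a b} h := by
    refine ⟨ofNat k (b.1 - a.1), Subtype.ext ?_⟩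
    rw [val_add, val_ofNat]
    have := b.2
    have := le_iff_val_le.1 h
    omega
  le_self_add a b := by
    rw [le_iff_val_le, val_add]
    exact le_min le_self_add a.2
  le_add_self a b := by
    rw [le_iff_val_le, val_add]
    exact le_min le_add_self a.2

instance : WellFoundedGT (CollapsedNat k) :=
  haveI : Finite (CollapsedNat k) := inferInstanceAs (Finite (Set.Iic k))
  inferInstance

theorem ofENat_coe (n : ℕ) : ofENat k n = ofNat k n := by
  have h : min (n : ℕ∞) k = (min n k : ℕ) := (Nat.mono_cast.map_min (a := n) (b := k)).symm
  rw [ofENat, h, ENat.toNat_natCast]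
  exact Subtype.ext (min_eq_left (min_le_right n k) |>.trans rfl)

theorem ofENat_top : ofENat k ⊤ = ofNat k k := by
  rw [ofENat, min_eq_right le_top, ENat.toNat_natCast]

theorem ofENat_le_iff {x : ℕ∞} {a : CollapsedNat k} :
    ofENat k x ≤ a ↔ ∀ n : ℕ, (n : ℕ∞) ≤ x → ofENat k n ≤ a := by
  cases x with
  | top =>
    simp only [ofENat_top, ofENat_coe, le_top, true_implies, le_iff_val_le, val_ofNat]
    exact ⟨fun h n => by omega, fun h => h k⟩
  | coe m =>
    simp only [ofENat_coe, Nat.cast_le, le_iff_val_le, val_ofNat]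
    exact ⟨fun h n hn => by omega, fun h => h m le_rfl⟩

theorem ofENat_add (x y : ℕ∞) : ofENat k (x + y) = ofENat k x + ofENat k y := by
  have htop (c : CollapsedNat k) : ofNat k k = ofNat k k + c :=
    Subtype.ext (by rw [val_add, val_ofNat]; omega)
  cases x with
  | top => rw [top_add, ofENat_top, ← htop]
  | coe m =>
    cases y with
    | top => rw [add_top, ofENat_top, add_comm, ← htop]
    | coe n => rw [← Nat.cast_add, ofENat_coe, ofENat_coe, ofENat_coe, ofNat_add]

theorem ofENat_top_mul (y : ℕ∞) : ofENat k (⊤ * y) = ofENat k ⊤ * ofENat k y := by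
  have htop (n : ℕ) (hn : 0 < n) : ofNat k k = ofNat k k * ofNat k n := by
    rw [← ofNat_mul]
    have := Nat.le_mul_of_pos_right k hn
    exact Subtype.ext (by rw [val_ofNat, val_ofNat]; omega)
  cases y with
  | top =>
    rw [ENat.top_mul ENat.top_ne_zero, ofENat_top]
    rcases k.eq_zero_or_pos with rfl | hk
    · exact Subtype.ext rfl
    · exact htop k hk
  | coe n =>
    rcases n.eq_zero_or_pos with rfl | hn
    · rw [Nat.cast_zero, mul_zero, ← Nat.cast_zero, ofENat_coe, ofENat_top, ← ofNat_mul, mul_zero]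
    · rw [ENat.top_mul (by exact_mod_cast hn.ne'), ofENat_top, ofENat_coe, ← htop n hn]

theorem ofENat_mul (x y : ℕ∞) : ofENat k (x * y) = ofENat k x * ofENat k y := by
  cases x with
  | top => exact ofENat_top_mul y
  | coe m =>
    cases y with
    | top => rw [mul_comm, ofENat_top_mul, mul_comm]
    | coe n => rw [← Nat.cast_mul, ofENat_coe, ofENat_coe, ofENat_coe, ofNat_mul]

/-- The projection `ℕ ∪ {∞} → ℕ_k` as a homomorphism of semirings. -/
def ofENatHom (k : ℕ) : ℕ∞ →+* CollapsedNat k where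
  toFun := ofENat k
  map_zero' := ofENat_coe 0
  map_one' := ofENat_coe 1
  map_add' := ofENat_add
  map_mul' := ofENat_mul

end CollapsedNat

/-! ### Kleene stars and linear systems -/

open Filter in
theorem eventually_coeff_mul_eq {σ R : Type*} [CommSemiring R] {f : ℕ → MvPowerSeries σ R}
    {s : MvPowerSeries σ R}
    (hf : ∀ v, ∀ᶠ n in atTop, MvPowerSeries.coeff v (f n) = MvPowerSeries.coeff v s)
    (c : MvPowerSeries σ R) (v : σ →₀ ℕ) :
    ∀ᶠ n in atTop, MvPowerSeries.coeff v (c * f n) = MvPowerSeries.coeff v (c * s) := by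
  classical
  filter_upwards
    [(Finset.HasAntidiagonal.antidiagonal v).eventually_all.2 fun p _ => hf p.2] with n hn
  rw [MvPowerSeries.coeff_mul, MvPowerSeries.coeff_mul]
  exact Finset.sum_congr rfl fun p hp => congrArg _ (hn p hp)

section KleeneStar

open Filter

variable {σ R : Type*} [CommSemiring R] [PartialOrder R] [CanonicallyOrderedAdd R]

theorem monotone_sum_range_pow (a : MvPowerSeries σ R) :
    Monotone fun n => ∑ i ∈ Finset.range n, a ^ i :=
  monotone_nat_of_le_succ fun n => by
    rw [Finset.sum_range_succ]
    exact le_self_add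

theorem exists_isKleeneStar_eventually_eq [WellFoundedGT R] (a : MvPowerSeries σ R) :
    ∃ s, IsKleeneStar a s ∧ ∀ v, ∀ᶠ n in atTop,
      MvPowerSeries.coeff v (∑ i ∈ Finset.range n, a ^ i) = MvPowerSeries.coeff v s := by
  let partialSum (v : σ →₀ ℕ) : ℕ →o R :=
    ⟨fun n => MvPowerSeries.coeff v (∑ i ∈ Finset.range n, a ^ i),
      fun _ _ h => monotone_sum_range_pow a h v⟩
  choose N hN using fun v => WellFoundedGT.monotone_chain_condition (partialSum v)
  refine ⟨fun v => partialSum v (N v), ⟨fun n => ?_, fun u hu => ?_⟩,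
    fun v => eventually_atTop.2 ⟨N v, fun n hn => (hN v n hn).symm⟩⟩
  · refine naturalLE_iff_le.2 fun v => ?_
    exact ((partialSum v).monotone (le_max_left n (N v))).trans_eq
      (hN v _ (le_max_right n (N v))).symm
  · exact naturalLE_iff_le.2 fun v => naturalLE_iff_le.1 (hu (N v)) v

theorem exists_isKleeneStar_isLeast [WellFoundedGT R] (a : MvPowerSeries σ R) :
    ∃ s, IsKleeneStar a s ∧ ∀ b, IsLeast {x | a * x + b ≤ x} (s * b) := by
  obtain ⟨s, hs, hlim⟩ := exists_isKleeneStar_eventually_eq a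
  have hsucc (n : ℕ) :
      ∑ i ∈ Finset.range (n + 1), a ^ i = a * ∑ i ∈ Finset.range n, a ^ i + 1 := by
    rw [Finset.sum_range_succ', Finset.mul_sum, pow_zero]
    simp only [pow_succ']
  have hfix : a * s + 1 ≤ s := fun v => by
    obtain ⟨n, hn⟩ := (eventually_coeff_mul_eq hlim a v).exists
    have h := naturalLE_iff_le.1 (hs.1 (n + 1)) v
    rw [hsucc] at h
    exact (congrArg (· + MvPowerSeries.coeff v 1) hn).ge.trans h
  refine ⟨s, hs, fun b => ⟨?_, fun x hx => ?_⟩⟩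
  · calc a * (s * b) + b = (a * s + 1) * b := by ring
      _ ≤ s * b := by gcongr
  · have hpartial (n : ℕ) : b * ∑ i ∈ Finset.range n, a ^ i ≤ x := by
      induction n with
      | zero => simp
      | succ n ih =>
        calc b * ∑ i ∈ Finset.range (n + 1), a ^ i
            = a * (b * ∑ i ∈ Finset.range n, a ^ i) + b := by rw [hsucc]; ring
          _ ≤ a * x + b := by gcongr
          _ ≤ x := hx
    rw [mul_comm]
    intro v
    obtain ⟨n, hn⟩ := (eventually_coeff_mul_eq hlim b v).exists
    exact hn.ge.trans (hpartial n v)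

end KleeneStar

section LinearSystem

open Matrix

variable {ι S : Type*} [Fintype ι] [CommSemiring S]

/-- The coefficient matrix that remains of a linear system `A *ᵥ x + b ≤ x` after the unknown with
index `none` has been eliminated by means of the star `s` of `A none none`. -/
def eliminatedMatrix (A : Matrix (Option ι) (Option ι) S) (s : S) : Matrix ι ι S :=
  .of fun i j => A (some i) none * (s * A none (some j)) + A (some i) (some j)

/-- The constant terms that remain of a linear system `A *ᵥ x + b ≤ x` after the unknown with index
`none` has been eliminated by means of the star `s` of `A none none`. -/
def eliminatedVec (A : Matrix (Option ι) (Option ι) S) (b : Option ι → S) (s : S) : ι → S :=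
  fun i => A (some i) none * (s * b none) + b (some i)

/-- The value of the eliminated unknown, given the values `x` of the remaining ones. -/
def eliminatedValue (A : Matrix (Option ι) (Option ι) S) (b : Option ι → S) (s : S) (x : ι → S) :
    S :=
  s * (∑ j, A none (some j) * x j + b none)

variable (A : Matrix (Option ι) (Option ι) S) (b : Option ι → S) (s : S)

theorem eliminatedMatrix_mulVec_add (x : ι → S) (i : ι) :
    (eliminatedMatrix A s *ᵥ x + eliminatedVec A b s) i =
      A (some i) none * eliminatedValue A b s x + ∑ j, A (some i) (some j) * x j + b (some i) := by
  simp only [eliminatedMatrix, eliminatedVec, eliminatedValue, Pi.add_apply, mulVec, dotProduct,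
    of_apply, add_mul, Finset.sum_add_distrib, mul_add, Finset.mul_sum, mul_assoc]
  ring

theorem mulVec_add_option (x : Option ι → S) (o : Option ι) :
    (A *ᵥ x + b) o = A o none * x none + (∑ j, A o (some j) * x (some j) + b o) := by
  rw [Pi.add_apply, mulVec, dotProduct, Fintype.sum_option, add_assoc]

variable [PartialOrder S]

theorem isLeast_mulVec_add_le_of_equiv {κ : Type*} [Fintype κ] {A : Matrix κ κ S} {b : κ → S}
    (e : ι ≃ κ) {x : ι → S} (hx : IsLeast {x | A.submatrix e e *ᵥ x + b ∘ e ≤ x} x) :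
    IsLeast {x | A *ᵥ x + b ≤ x} (x ∘ e.symm) := by
  have hsubmatrix (y : κ → S) : A.submatrix e e *ᵥ (y ∘ e) + b ∘ e = (A *ᵥ y + b) ∘ e := by
    rw [submatrix_mulVec_equiv, Function.comp_assoc, e.self_comp_symm]
    rfl
  constructor
  · refine (e.surjective.forall).2 fun i => ?_
    have h := hx.1 i
    rwa [show x = (x ∘ e.symm) ∘ e by simp [Function.comp_assoc], hsubmatrix] at h
  · intro y hy
    have h : x ≤ y ∘ e := hx.2 ((hsubmatrix y).trans_le fun i => hy (e i))
    exact (e.surjective.forall).2 fun i => (congrArg x (e.symm_apply_apply i)).trans_le (h i)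

variable [CanonicallyOrderedAdd S] {A b s}

theorem isLeast_mulVec_add_le_option (hs : ∀ c, IsLeast {z | A none none * z + c ≤ z} (s * c))
    {x : ι → S} (hx : IsLeast {x | eliminatedMatrix A s *ᵥ x + eliminatedVec A b s ≤ x} x) :
    IsLeast {x | A *ᵥ x + b ≤ x} fun o => o.elim (eliminatedValue A b s x) x := by
  constructor
  · rintro (_ | i)
    · rw [mulVec_add_option]
      exact (hs _).1
    · rw [mulVec_add_option, ← add_assoc]
      exact (eliminatedMatrix_mulVec_add A b s x i).ge.trans (hx.1 i)
  · intro y hy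
    have hnone : eliminatedValue A b s (y ∘ some) ≤ y none :=
      (hs _).2 ((mulVec_add_option A b y none).ge.trans (hy none))
    have hsome : x ≤ y ∘ some := hx.2 fun i => by
      calc (eliminatedMatrix A s *ᵥ (y ∘ some) + eliminatedVec A b s) i
          = A (some i) none * eliminatedValue A b s (y ∘ some) +
              (∑ j, A (some i) (some j) * y (some j) + b (some i)) := by
            rw [eliminatedMatrix_mulVec_add, add_assoc]; rfl
        _ ≤ A (some i) none * y none + (∑ j, A (some i) (some j) * y (some j) + b (some i)) := by
            gcongr
        _ = (A *ᵥ y + b) (some i) := (mulVec_add_option A b y (some i)).symm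
        _ ≤ y (some i) := hy (some i)
    rintro (_ | i)
    · refine le_trans ?_ hnone
      change s * _ ≤ s * _
      gcongr with j
      exact hsome j
    · exact hsome i

end LinearSystem

namespace IsRationalSeries

variable {σ R : Type*} [CommSemiring R]

theorem zero : IsRationalSeries (0 : MvPowerSeries σ R) := by
  simpa only [map_zero] using const (σ := σ) (0 : R)

theorem one : IsRationalSeries (1 : MvPowerSeries σ R) := by
  simpa only [map_one] using const (σ := σ) (1 : R)

theorem sum {ι : Type*} (s : Finset ι) {f : ι → MvPowerSeries σ R}
    (h : ∀ i ∈ s, IsRationalSeries (f i)) : IsRationalSeries (∑ i ∈ s, f i) :=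
  Finset.sum_induction f IsRationalSeries (fun _ _ => add) zero h

theorem prod {ι : Type*} (s : Finset ι) {f : ι → MvPowerSeries σ R}
    (h : ∀ i ∈ s, IsRationalSeries (f i)) : IsRationalSeries (∏ i ∈ s, f i) :=
  Finset.prod_induction f IsRationalSeries (fun _ _ => mul) one h

end IsRationalSeries

open Matrix in
theorem exists_isRationalSeries_isLeast_mulVec_add_le {ι σ R : Type*} [Fintype ι] [CommSemiring R]
    [PartialOrder R] [CanonicallyOrderedAdd R] [WellFoundedGT R]
    (A : Matrix ι ι (MvPowerSeries σ R)) (b : ι → MvPowerSeries σ R)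
    (hA : ∀ i j, IsRationalSeries (A i j)) (hb : ∀ i, IsRationalSeries (b i)) :
    ∃ x, (∀ i, IsRationalSeries (x i)) ∧ IsLeast {x | A *ᵥ x + b ≤ x} x := by
  revert A b
  refine Fintype.induction_empty_option (P := fun ι _ =>
    ∀ (A : Matrix ι ι (MvPowerSeries σ R)) (b : ι → MvPowerSeries σ R),
    (∀ i j, IsRationalSeries (A i j)) → (∀ i, IsRationalSeries (b i)) →
    ∃ x, (∀ i, IsRationalSeries (x i)) ∧ IsLeast {x | A *ᵥ x + b ≤ x} x) ?_ ?_ ?_ ι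
  · intro α β _ e ih A b hA hb
    let _ := Fintype.ofEquiv β e.symm
    obtain ⟨x, hxrat, hx⟩ := ih (A.submatrix e e) (b ∘ e) (fun _ _ => hA _ _) fun _ => hb _
    exact ⟨x ∘ e.symm, fun i => hxrat _, isLeast_mulVec_add_le_of_equiv e hx⟩
  · intro A b _ _
    exact ⟨PEmpty.elim, fun i => i.elim, fun i => i.elim, fun _ _ i => i.elim⟩
  · intro ι _ ih A b hA hb
    obtain ⟨s, hs, hleast⟩ := exists_isKleeneStar_isLeast (A none none)
    have hsrat : IsRationalSeries s := (hA _ _).star hs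
    obtain ⟨x, hxrat, hx⟩ := ih (eliminatedMatrix A s) (eliminatedVec A b s)
      (fun i j => ((hA _ _).mul (hsrat.mul (hA _ _))).add (hA _ _))
      (fun i => ((hA _ _).mul (hsrat.mul (hb _))).add (hb _))
    refine ⟨_, ?_, isLeast_mulVec_add_le_option hleast hx⟩
    rintro (_ | i)
    · exact hsrat.mul ((IsRationalSeries.sum _ fun j _ => (hA _ _).mul (hxrat j)).add (hb none))
    · exact hxrat i

/-! ### Least solutions of polynomial systems -/

theorem attrPoly_mono {T N Q R : Type*} [CommSemiring R] [PartialOrder R] [CanonicallyOrderedAdd R]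
    {P : Finset (ContextFreeRule T N)} {X : N}
    {Δ : ∀ r : ContextFreeRule T N, Finset (Fin (varsOf r.output).length → Q)}
    {y z : N → Q → MvPowerSeries T R}
    (h : ∀ r, ∀ δ ∈ Δ r, ∀ i,
      y ((varsOf r.output).get i) (δ i) ≤ z ((varsOf r.output).get i) (δ i)) :
    attrPoly P X Δ y ≤ attrPoly P X Δ z := by
  unfold attrPoly
  gcongr with r _ δ hδ i
  exact h r δ hδ i

theorem weightSeries_empty {T α : Type*} (w : α → T →₀ ℕ) : weightSeries w ∅ = 0 := by
  ext v
  simp [coeff_weightSeries]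

/-- A homomorphism from `ℕ ∪ {∞}` is finitely determined if it maps `∞` to the supremum of the
images of the natural numbers; the limit of an increasing sequence of finite counts is then
preserved. -/
def FinitelyDetermined {R : Type*} [CommSemiring R] [PartialOrder R] (φ : ℕ∞ →+* R) : Prop :=
  ∀ ⦃x : ℕ∞⦄ ⦃y : R⦄, (∀ n : ℕ, n ≤ x → φ n ≤ y) → φ x ≤ y

theorem finitelyDetermined_id : FinitelyDetermined (RingHom.id ℕ∞) := fun _ _ h =>
  ENat.forall_natCast_le_iff_le.1 h

theorem finitelyDetermined_ofENatHom (k : ℕ) : FinitelyDetermined (CollapsedNat.ofENatHom k) :=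
  fun _ _ h => CollapsedNat.ofENat_le_iff.2 h

section Leastness

variable {T R : Type*} [CommSemiring R] [PartialOrder R] [CanonicallyOrderedAdd R] {φ : ℕ∞ →+* R}

theorem FinitelyDetermined.map_weightSeries_le (hφ : FinitelyDetermined φ) {α : Type*}
    (w : α → T →₀ ℕ) (A : Set α) (size : α → ℕ) {y : MvPowerSeries T R}
    (hy : ∀ h, MvPowerSeries.map φ (weightSeries w {a ∈ A | size a ≤ h}) ≤ y) :
    MvPowerSeries.map φ (weightSeries w A) ≤ y := fun v => hφ fun n hn => by
  obtain ⟨U, hUA, hU⟩ := Set.exists_subset_encard_eq hn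
  obtain ⟨h, hsize⟩ := ((Set.finite_of_encard_eq_coe hU).image size).bddAbove
  have hle : (n : ℕ∞) ≤ {a ∈ {a ∈ A | size a ≤ h} | w a = v}.encard :=
    hU.ge.trans (Set.encard_le_encard fun a ha =>
      ⟨⟨(hUA ha).1, hsize (Set.mem_image_of_mem size ha)⟩, (hUA ha).2⟩)
  obtain ⟨m, hm⟩ := le_iff_exists_add.1 hle
  calc φ n ≤ φ n + φ m := le_self_add
    _ = φ {a ∈ {a ∈ A | size a ≤ h} | w a = v}.encard := by rw [hm, map_add]
    _ ≤ y v := hy h v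

variable {G : ContextFreeGrammar T} {Q : Type*}

theorem DerivTree.map_weightSeries_le (hφ : FinitelyDetermined φ)
    (c : ∀ {X : G.NT}, DerivTree G X → Q)
    (Δ : Q → ∀ r : ContextFreeRule T G.NT, Finset (Fin (varsOf r.output).length → Q))
    (hc : ∀ q r hr f, c (node r hr f) = q ↔ (fun i => c (f i)) ∈ Δ q r) (D : Set Q)
    (hD : ∀ q ∈ D, ∀ r, ∀ δ ∈ Δ q r, ∀ i, δ i ∈ D) {y : G.NT → Q → MvPowerSeries T R}
    (hy : ∀ X, ∀ q ∈ D, attrPoly G.rules X (Δ q) y ≤ y X q) (X : G.NT) {q : Q} (hq : q ∈ D) :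
    MvPowerSeries.map φ (weightSeries parikh {t : DerivTree G X | c t = q}) ≤ y X q := by
  refine hφ.map_weightSeries_le _ _ height fun h => ?_
  induction h generalizing X q with
  | zero =>
    have hempty : {t ∈ {t : DerivTree G X | c t = q} | t.height ≤ 0} = ∅ :=
      Set.eq_empty_of_forall_notMem fun t ht => by
        cases t
        exact absurd ht.2 (by simp [height])
    rw [hempty, weightSeries_empty, map_zero]
    exact zero_le
  | succ h ih =>
    rw [weightSeries_eq_attrPoly c (Δ q) (fun X => {t ∈ {t | c t = q} | t.height ≤ h + 1})
      (fun X => {t | t.height ≤ h}), map_attrPoly]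
    · refine (attrPoly_mono fun r δ hδ i => ?_).trans (hy X q hq)
      simpa only [Set.mem_ofPred_eq, and_comm] using ih _ (hD q hq r δ hδ i)
    · intro r hr f
      simp only [Set.mem_ofPred_eq, hc, height, add_le_add_iff_right, Finset.sup_le_iff,
        Finset.mem_univ, true_implies]

end Leastness

/-! ### Rationality in bounded dimension -/

/-- The attributes `δ : Fin n → ℕ` with Strahler number `e`. -/
def strahlerFiber (n e : ℕ) : Finset (Fin n → ℕ) :=
  {δ ∈ Fintype.piFinset fun _ => Finset.range (e + 1) | strahler δ = e}

theorem mem_strahlerFiber {n e : ℕ} {δ : Fin n → ℕ} : δ ∈ strahlerFiber n e ↔ strahler δ = e := by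
  simp only [strahlerFiber, Finset.mem_filter, Fintype.mem_piFinset, Finset.mem_range,
    Nat.lt_succ_iff, and_iff_right_iff_imp]
  rintro rfl i
  exact le_strahler δ i

theorem lt_of_mem_strahlerFiber {n e : ℕ} {δ : Fin n → ℕ} (hδ : δ ∈ strahlerFiber n e)
    {i j : Fin n} (hj : δ j = e) (hij : i ≠ j) : δ i < e := by
  obtain ⟨hle, huniq⟩ := strahler_le_iff.1 (mem_strahlerFiber.1 hδ).le
  exact (hle i).lt_of_ne fun hi => hij (huniq hi hj)

section LinearPart

variable {T N R : Type*} [CommSemiring R] {y z : N → ℕ → MvPowerSeries T R} {e : ℕ}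

/-- The coefficient of `y Y e` in the product `∏ i, y (V i) (δ i)`, for `δ` of Strahler number `e`
and `y` equal to `z` below `e`. -/
def prodCoeff {n : ℕ} (V : Fin n → N) (δ : Fin n → ℕ) (z : N → ℕ → MvPowerSeries T R) (e : ℕ)
    (Y : N) : MvPowerSeries T R :=
  open Classical in
  ∑ j with δ j = e ∧ V j = Y, ∏ i ∈ Finset.univ.erase j, z (V i) (δ i)

theorem prod_eq_sum_prodCoeff [Fintype N] {n : ℕ} (V : Fin n → N) {δ : Fin n → ℕ}
    (hδ : δ ∈ strahlerFiber n e) (hyz : ∀ X, ∀ m < e, y X m = z X m) :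
    ∏ i, y (V i) (δ i) = ∑ Y, prodCoeff V δ z e Y * y Y e +
      if ∀ j, δ j < e then ∏ i, z (V i) (δ i) else 0 := by
  classical
  split_ifs with hlt
  · have hcoeff : ∀ Y, prodCoeff V δ z e Y = 0 := fun Y =>
      Finset.sum_eq_zero fun j hj => absurd (Finset.mem_filter.1 hj).2.1 (hlt j).ne
    simp only [hcoeff, zero_mul, Finset.sum_const_zero, zero_add]
    exact Finset.prod_congr rfl fun i _ => hyz _ _ (hlt i)
  · obtain ⟨j, hj⟩ : ∃ j, δ j = e := by
      by_contra! hne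
      exact hlt fun j => (mem_strahlerFiber.1 hδ ▸ le_strahler δ j).lt_of_ne (hne j)
    have hsupport : ∀ Y, ({l | δ l = e ∧ V l = Y} : Finset (Fin n)) =
        if V j = Y then {j} else ∅ := fun Y => by
      ext l
      have hl : δ l = e → l = j := fun hl => by_contra fun hne =>
        (lt_of_mem_strahlerFiber hδ hj hne).ne hl
      split_ifs <;> grind
    have hrest : ∏ i ∈ Finset.univ.erase j, y (V i) (δ i) =
        ∏ i ∈ Finset.univ.erase j, z (V i) (δ i) := Finset.prod_congr rfl fun i hi =>
      hyz _ _ (lt_of_mem_strahlerFiber hδ hj (Finset.ne_of_mem_erase hi))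
    rw [← Finset.prod_erase_mul _ _ (Finset.mem_univ j), hrest, hj, add_zero,
      Finset.sum_eq_single_of_mem (V j) (Finset.mem_univ _)]
    · simp [prodCoeff, hsupport]
    · intro Y _ hY
      simp [prodCoeff, hsupport, hY.symm]

/-- The matrix of the system for the trees of dimension `e`, which is linear once the series `z Y m`
of the trees of dimension `m < e` are known. -/
def linearCoeff (P : Finset (ContextFreeRule T N)) (z : N → ℕ → MvPowerSeries T R) (e : ℕ) :
    Matrix N N (MvPowerSeries T R) :=
  open Classical in
  fun X Y => ∑ r ∈ P with r.input = X, MvPowerSeries.monomial (terminalParikh r.output) 1 *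
    ∑ δ ∈ strahlerFiber (varsOf r.output).length e, prodCoeff (varsOf r.output).get δ z e Y

/-- The constant terms of the linear system with the matrix `linearCoeff P z e`. -/
def linearConst (P : Finset (ContextFreeRule T N)) (z : N → ℕ → MvPowerSeries T R) (e : ℕ) (X : N) :
    MvPowerSeries T R :=
  open Classical in
  ∑ r ∈ P with r.input = X, MvPowerSeries.monomial (terminalParikh r.output) 1 *
    ∑ δ ∈ strahlerFiber (varsOf r.output).length e,
      if ∀ j, δ j < e then ∏ i, z ((varsOf r.output).get i) (δ i) else 0

open Matrix in
theorem attrPoly_eq_mulVec_add [Fintype N] (P : Finset (ContextFreeRule T N))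
    (hyz : ∀ X, ∀ m < e, y X m = z X m) (X : N) :
    attrPoly P X (fun r => strahlerFiber (varsOf r.output).length e) y =
      (linearCoeff P z e *ᵥ (fun Y => y Y e) + linearConst P z e) X := by
  classical
  simp only [attrPoly, linearCoeff, linearConst, Pi.add_apply, Matrix.mulVec, dotProduct,
    Finset.sum_mul]
  rw [Finset.sum_comm, ← Finset.sum_add_distrib]
  refine Finset.sum_congr rfl fun r _ => ?_
  simp only [mul_assoc, ← Finset.mul_sum, ← mul_add, Finset.sum_mul]
  rw [Finset.sum_comm, ← Finset.sum_add_distrib]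
  exact congrArg _ (Finset.sum_congr rfl fun δ hδ => prod_eq_sum_prodCoeff _ hδ hyz)

theorem isRationalSeries_linearCoeff (P : Finset (ContextFreeRule T N))
    (hz : ∀ X, ∀ m < e, IsRationalSeries (z X m)) (X Y : N) :
    IsRationalSeries (linearCoeff P z e X Y) := by
  classical
  exact .sum _ fun _ _ => (IsRationalSeries.monom _).mul <| .sum _ fun _ hδ => .sum _ fun _ hj =>
    .prod _ fun _ hi => hz _ _ <| lt_of_mem_strahlerFiber hδ (Finset.mem_filter.1 hj).2.1
      (Finset.ne_of_mem_erase hi)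

theorem isRationalSeries_linearConst (P : Finset (ContextFreeRule T N))
    (hz : ∀ X, ∀ m < e, IsRationalSeries (z X m)) (X : N) :
    IsRationalSeries (linearConst P z e X) := by
  refine .sum _ fun r _ => (IsRationalSeries.monom _).mul (.sum _ fun δ _ => ?_)
  split_ifs with hδ
  · exact .prod _ fun i _ => hz _ _ (hδ i)
  · exact .zero

end LinearPart

section dimSeries

variable {T : Type*}

/-- The series that counts the trees of dimension `e` by their Parikh vectors. -/
def dimSeries (G : ContextFreeGrammar T) (X : G.NT) (e : ℕ) : MvPowerSeries T ℕ∞ :=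
  weightSeries DerivTree.parikh {t : DerivTree G X | t.dim = e}

variable {G : ContextFreeGrammar T}

theorem dimSeries_eq_attrPoly (X : G.NT) (e : ℕ) :
    dimSeries G X e =
      attrPoly G.rules X (fun r => strahlerFiber (varsOf r.output).length e) (dimSeries G) := by
  have h := DerivTree.weightSeries_eq_attrPoly DerivTree.dim
    (fun r => strahlerFiber (varsOf r.output).length e) (fun X => {t | t.dim = e})
    (fun _ => Set.univ) (fun r _ f => by simp [mem_strahlerFiber, DerivTree.dim_node]) X
  simp only [Set.mem_univ, true_and] at h
  exact h

variable {R : Type*} [CommSemiring R] [PartialOrder R] [CanonicallyOrderedAdd R] {φ : ℕ∞ →+* R}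

theorem map_dimSeries_le (hφ : FinitelyDetermined φ) {y : G.NT → ℕ → MvPowerSeries T R} {d : ℕ}
    (hy : ∀ X, ∀ e ≤ d,
      attrPoly G.rules X (fun r => strahlerFiber (varsOf r.output).length e) y ≤ y X e)
    (X : G.NT) {e : ℕ} (he : e ≤ d) : MvPowerSeries.map φ (dimSeries G X e) ≤ y X e :=
  DerivTree.map_weightSeries_le hφ DerivTree.dim
    (fun e r => strahlerFiber (varsOf r.output).length e)
    (fun e r _ f => by rw [mem_strahlerFiber, DerivTree.dim_node]) (Set.Iic d)
    (fun e he r δ hδ i => ((le_strahler δ i).trans_eq (mem_strahlerFiber.1 hδ)).trans he)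
    hy X he

theorem isRationalSeries_map_dimSeries [Finite G.NT] [WellFoundedGT R]
    (hφ : FinitelyDetermined φ) (X : G.NT) (e : ℕ) :
    IsRationalSeries (MvPowerSeries.map φ (dimSeries G X e)) := by
  cases nonempty_fintype G.NT
  induction e using Nat.strong_induction_on generalizing X with
  | _ e ih =>
    let z : G.NT → ℕ → MvPowerSeries T R := fun Y m => MvPowerSeries.map φ (dimSeries G Y m)
    have z_eq : ∀ Y m, attrPoly G.rules Y (fun r => strahlerFiber (varsOf r.output).length m) z =
        z Y m := fun Y m => by
      rw [← map_attrPoly, ← dimSeries_eq_attrPoly]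
    obtain ⟨x, hx, hsol, hleast⟩ := exists_isRationalSeries_isLeast_mulVec_add_le
      (linearCoeff G.rules z e) (linearConst G.rules z e)
      (isRationalSeries_linearCoeff _ fun Y m hm => ih m hm Y)
      (isRationalSeries_linearConst _ fun Y m hm => ih m hm Y)
    have hxz : x ≤ fun Y => z Y e := hleast fun Y =>
      ((attrPoly_eq_mulVec_add G.rules (fun _ _ _ => rfl) Y).symm.trans (z_eq Y e)).le
    let y : G.NT → ℕ → MvPowerSeries T R := fun Y => Function.update (z Y) e (x Y)
    have y_of_lt : ∀ Y, ∀ m < e, y Y m = z Y m := fun Y m hm => Function.update_of_ne hm.ne _ _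
    have y_self : ∀ Y, y Y e = x Y := fun Y => Function.update_self _ _ _
    have y_le : ∀ Y m, y Y m ≤ z Y m := fun Y m => by
      rcases eq_or_ne m e with rfl | hm
      · exact (y_self Y).trans_le (hxz Y)
      · exact (Function.update_of_ne hm _ _).le
    have hy : ∀ Y, ∀ m ≤ e,
        attrPoly G.rules Y (fun r => strahlerFiber (varsOf r.output).length m) y ≤ y Y m := by
      intro Y m hm
      rcases hm.lt_or_eq with hm | rfl
      · rw [y_of_lt Y m hm, ← z_eq]
        exact attrPoly_mono fun r δ _ i => y_le _ _
      · rw [attrPoly_eq_mulVec_add G.rules y_of_lt, y_self, funext y_self]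
        exact hsol Y
    have hzx : z X e ≤ x X := (map_dimSeries_le hφ hy X le_rfl).trans_eq (y_self X)
    have x_eq : x X = MvPowerSeries.map φ (dimSeries G X e) := (hxz X).antisymm hzx
    exact x_eq ▸ hx X

end dimSeries

/-! ### Commutative ambiguity as a least solution -/

section camb

variable {T : Type*}

/-- The right-hand side for `X` in the polynomial system of a set `P` of rules: the sum of
`u₀ u₁ … u_r · y X₁ ⋯ y X_r` over the rules `X → u₀ X₁ u₁ … X_r u_r`. -/
def grammarPoly {N R : Type*} [CommSemiring R] (P : Finset (ContextFreeRule T N)) (X : N)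
    (y : N → MvPowerSeries T R) : MvPowerSeries T R :=
  open Classical in
  ∑ r ∈ P with r.input = X,
    MvPowerSeries.monomial (terminalParikh r.output) 1 * ((varsOf r.output).map y).prod

theorem attrPoly_unit {N R : Type*} [CommSemiring R] (P : Finset (ContextFreeRule T N)) (X : N)
    (y : N → Unit → MvPowerSeries T R) :
    attrPoly P X (fun _ => Finset.univ) y = grammarPoly P X fun Y => y Y () :=
  Finset.sum_congr rfl fun r _ => by
    rw [Fintype.sum_unique, ← Fin.prod_univ_fun_getElem]
    rfl

variable {G : ContextFreeGrammar T}

theorem camb_eq_weightSeries (X : G.NT) :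
    camb G X = weightSeries DerivTree.parikh (Set.univ : Set (DerivTree G X)) := by
  ext v
  simp only [coeff_weightSeries, Set.mem_univ, true_and]
  rfl

theorem camb_eq_grammarPoly (X : G.NT) : camb G X = grammarPoly G.rules X (camb G) := by
  have h := DerivTree.weightSeries_eq_attrPoly (G := G) (fun _ => ()) (fun _ => Finset.univ)
    (fun _ => Set.univ) (fun _ => Set.univ) (by simp) X
  simp only [attrPoly_unit, and_true, Set.ofPred_mem_eq, ← camb_eq_weightSeries] at h
  exact h

theorem camb_le {y : G.NT → MvPowerSeries T ℕ∞} (hy : ∀ X, grammarPoly G.rules X y ≤ y X)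
    (X : G.NT) : camb G X ≤ y X := by
  have h := DerivTree.map_weightSeries_le finitelyDetermined_id (G := G) (fun _ => ())
    (fun _ _ => Finset.univ) (by simp) Set.univ (by simp) (y := fun X _ => y X)
    (fun X _ _ => by rw [attrPoly_unit]; exact hy X) X (Set.mem_univ ())
  rw [camb_eq_weightSeries]
  simpa only [MvPowerSeries.map_id, RingHom.id_apply, Set.ofPred_true] using h

end camb

/-! ### Relabelled sentential forms -/

section relabel

variable {T N N' : Type*}

theorem terminalParikh_relabel (γ : List (Symbol T N)) (Z : Fin (varsOf γ).length → N') :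
    terminalParikh (relabel γ Z) = terminalParikh γ := by
  induction γ with
  | nil => rfl
  | cons s γ ih =>
    cases s with
    | terminal a => exact congrArg _ (ih Z)
    | nonterminal X => exact ih fun i => Z i.succ

theorem varsOf_relabel (γ : List (Symbol T N)) (Z : Fin (varsOf γ).length → N') :
    varsOf (relabel γ Z) = List.ofFn Z := by
  induction γ with
  | nil => rfl
  | cons s γ ih =>
    cases s with
    | terminal a => exact ih Z
    | nonterminal X =>
      rw [show List.ofFn Z = _ from List.ofFn_succ (n := (varsOf γ).length), ← ih]
      rfl

theorem relabel_injective (γ : List (Symbol T N)) :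
    Function.Injective (relabel γ : (Fin (varsOf γ).length → N') → _) := fun Z Z' h =>
  List.ofFn_injective <| by rw [← varsOf_relabel, h, varsOf_relabel]

/-- The action of a map of variables on symbols. -/
def mapSymbol (g : N' → N) : Symbol T N' → Symbol T N
  | .terminal a => .terminal a
  | .nonterminal Z => .nonterminal (g Z)

theorem map_relabel (g : N' → N) (γ : List (Symbol T N)) (Z : Fin (varsOf γ).length → N')
    (h : ∀ i, g (Z i) = (varsOf γ).get i) : (relabel γ Z).map (mapSymbol g) = γ := by
  induction γ with
  | nil => rfl
  | cons s γ ih =>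
    cases s with
    | terminal a => exact congrArg (Symbol.terminal a :: ·) (ih Z h)
    | nonterminal X =>
      exact congrArg₂ (Symbol.nonterminal · :: ·) (h ⟨0, Nat.succ_pos _⟩)
        (ih _ fun i => h i.succ)

end relabel

/-! ### The rules of the unfolding -/

section patterns

variable {N : Type} {d n : ℕ}

/-- The variable of the original grammar underlying a variable of the unfolding. -/
def UnfoldVar.base : UnfoldVar N d → N
  | atMost X _ => X
  | exactly X _ => X

/-- The dimensions of the trees that a variable of the unfolding stands for. -/
def UnfoldVar.dims : UnfoldVar N d → Finset ℕ
  | atMost _ e => Finset.Iic e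
  | exactly _ e => {(e : ℕ)}

theorem UnfoldVar.mem_dims_atMost {X : N} {e : Fin (d + 1)} {m : ℕ} :
    m ∈ (atMost X e).dims ↔ m ≤ e := Finset.mem_Iic

theorem UnfoldVar.mem_dims_exactly {X : N} {e : Fin (d + 1)} {m : ℕ} :
    m ∈ (exactly X e).dims ↔ m = e := Finset.mem_singleton

open UnfoldVar in
/-- The choices of `Z₁, …, Z_r` in the rules `X^{= e} → u₀ Z₁ u₁ … Z_r u_r` of the unfolding, for a
rule `X → u₀ X₁ u₁ … X_r u_r` with the variables `V i`. The rules with `r = 1` are the case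
`single`, whose last condition is void for them. -/
inductive IsPattern (V : Fin n → N) (e : Fin (d + 1)) (Z : Fin n → UnfoldVar N d) : Prop
  | leaf (hn : n = 0) (he : e = 0)
  | single (j : Fin n) (hj : Z j = exactly (V j) e)
      (h : ∀ i ≠ j, ∃ f : Fin (d + 1), (f : ℕ) + 1 = e ∧ Z i = atMost (V i) f)
  | multi (J : Finset (Fin n)) (hJ : 2 ≤ J.card)
      (h : ∀ i ∈ J, ∃ f : Fin (d + 1), (f : ℕ) + 1 = e ∧ Z i = exactly (V i) f)
      (h' : ∀ i ∉ J, ∃ f : Fin (d + 1), (f : ℕ) + 2 = e ∧ Z i = atMost (V i) f)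

variable {V : Fin n → N} {e : Fin (d + 1)} {Z Z' : Fin n → UnfoldVar N d} {δ : Fin n → ℕ}

theorem IsPattern.base_eq (hZ : IsPattern V e Z) (i : Fin n) : (Z i).base = V i := by
  cases hZ with
  | leaf hn => exact absurd i.2 (by omega)
  | single j hj h =>
    rcases eq_or_ne i j with rfl | hij
    · rw [hj, UnfoldVar.base]
    · obtain ⟨f, -, hf⟩ := h i hij
      rw [hf, UnfoldVar.base]
  | multi J _ h h' =>
    by_cases hi : i ∈ J
    · obtain ⟨f, -, hf⟩ := h i hi
      rw [hf, UnfoldVar.base]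
    · obtain ⟨f, -, hf⟩ := h' i hi
      rw [hf, UnfoldVar.base]

theorem IsPattern.shape_of_mem_dims (hZ : IsPattern V e Z) (hδ : ∀ i, δ i ∈ (Z i).dims) :
    (n = 0 ∧ e = 0) ∨
    ((∃ j, δ j = e ∧ ∀ i ≠ j, δ i < e) ∧ ∀ i, δ i = e ∧ Z i = .exactly (V i) e ∨
      δ i < e ∧ ∃ f : Fin (d + 1), (f : ℕ) + 1 = e ∧ Z i = .atMost (V i) f) ∨
    ({i | δ i + 1 = e}.Nontrivial ∧ ∀ i,
      (δ i + 1 = e ∧ ∃ f : Fin (d + 1), (f : ℕ) + 1 = e ∧ Z i = .exactly (V i) f) ∨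
      δ i + 1 < e ∧ ∃ f : Fin (d + 1), (f : ℕ) + 2 = e ∧ Z i = .atMost (V i) f) := by
  have of_exactly : ∀ {i f}, Z i = .exactly (V i) f → δ i = f := fun h =>
    UnfoldVar.mem_dims_exactly.1 (h ▸ hδ _)
  have of_atMost : ∀ {i f}, Z i = .atMost (V i) f → δ i ≤ f := fun h =>
    UnfoldVar.mem_dims_atMost.1 (h ▸ hδ _)
  cases hZ with
  | leaf hn he => exact .inl ⟨hn, he⟩
  | single j hj h =>
    have lt : ∀ i ≠ j, δ i < e := fun i hij => by
      obtain ⟨f, hfe, hf⟩ := h i hij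
      have := of_atMost hf
      omega
    refine .inr (.inl ⟨⟨j, of_exactly hj, lt⟩, fun i => ?_⟩)
    rcases eq_or_ne i j with rfl | hij
    · exact .inl ⟨of_exactly hj, hj⟩
    · exact .inr ⟨lt i hij, h i hij⟩
  | multi J hJ h h' =>
    have eq : ∀ i ∈ J, δ i + 1 = e := fun i hi => by
      obtain ⟨f, hfe, hf⟩ := h i hi
      rw [of_exactly hf, hfe]
    obtain ⟨a, ha, b, hb, hab⟩ := Finset.one_lt_card.1 hJ
    refine .inr (.inr ⟨⟨a, eq a ha, b, eq b hb, hab⟩, fun i => ?_⟩)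
    by_cases hi : i ∈ J
    · exact .inl ⟨eq i hi, h i hi⟩
    · obtain ⟨f, hfe, hf⟩ := h' i hi
      have := of_atMost hf
      exact .inr ⟨by omega, f, hfe, hf⟩

theorem IsPattern.strahler_eq (hZ : IsPattern V e Z) (hδ : ∀ i, δ i ∈ (Z i).dims) :
    strahler δ = e := by
  refine strahler_eq_iff.2 ?_
  rcases hZ.shape_of_mem_dims hδ with ⟨rfl, rfl⟩ | ⟨h, -⟩ | ⟨h, hlt⟩
  · exact .inl ⟨inferInstance, rfl⟩
  · exact .inr (.inl h)
  · exact .inr (.inr ⟨fun i => by grind, h⟩)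

theorem IsPattern.eq_of_mem_dims (hZ : IsPattern V e Z) (hZ' : IsPattern V e Z')
    (hδ : ∀ i, δ i ∈ (Z i).dims) (hδ' : ∀ i, δ i ∈ (Z' i).dims) : Z = Z' := by
  have index_unique : ∀ {c} {f g : Fin (d + 1)}, (f : ℕ) + c = e → (g : ℕ) + c = e → f = g :=
    fun hf hg => Fin.ext (Nat.add_right_cancel (hf.trans hg.symm))
  funext i
  rcases hZ.shape_of_mem_dims hδ with ⟨rfl, -⟩ | ⟨⟨j, hj, -⟩, h⟩ | ⟨-, h⟩
  · exact i.elim0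
  all_goals rcases hZ'.shape_of_mem_dims hδ' with ⟨rfl, -⟩ | ⟨⟨j', hj', -⟩, h'⟩ | ⟨-, h'⟩
  · exact i.elim0
  · rcases h i with ⟨hi, hZi⟩ | ⟨hi, f, hf, hZi⟩ <;>
      rcases h' i with ⟨hi', hZi'⟩ | ⟨hi', f', hf', hZi'⟩
    · rw [hZi, hZi']
    · omega
    · omega
    · rw [hZi, hZi', index_unique hf hf']
  · have := h' j
    omega
  · exact i.elim0
  · have := h j'
    omega
  · rcases h i with ⟨hi, f, hf, hZi⟩ | ⟨hi, f, hf, hZi⟩ <;>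
      rcases h' i with ⟨hi', f', hf', hZi'⟩ | ⟨hi', f', hf', hZi'⟩
    · rw [hZi, hZi', index_unique hf hf']
    · omega
    · omega
    · rw [hZi, hZi', index_unique hf hf']

theorem exists_isPattern (V : Fin n → N) (hδ : strahler δ = e) :
    ∃ Z, IsPattern V e Z ∧ ∀ i, δ i ∈ (Z i).dims := by
  have index : ∀ c ≤ (e : ℕ), ∃ f : Fin (d + 1), (f : ℕ) + c = e := fun c hc =>
    ⟨⟨e - c, by omega⟩, Nat.sub_add_cancel hc⟩
  rcases strahler_eq_iff.1 hδ with ⟨hn, he⟩ | ⟨j, hj, hlt⟩ | ⟨hlt, hmax⟩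
  · exact ⟨isEmptyElim, .leaf (Nat.eq_zero_of_not_pos fun h => hn.elim ⟨0, h⟩) (Fin.ext he),
      isEmptyElim⟩
  · have child : ∀ i, ∃ z : UnfoldVar N d, δ i ∈ z.dims ∧ (i = j → z = .exactly (V i) e) ∧
        (i ≠ j → ∃ f : Fin (d + 1), (f : ℕ) + 1 = e ∧ z = .atMost (V i) f) := fun i => by
      rcases eq_or_ne i j with rfl | hij
      · exact ⟨_, UnfoldVar.mem_dims_exactly.2 hj, fun _ => rfl, fun h => absurd rfl h⟩
      · have := hlt i hij
        obtain ⟨f, hf⟩ := index 1 (by omega)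
        exact ⟨.atMost (V i) f, UnfoldVar.mem_dims_atMost.2 (by omega), fun h => absurd h hij,
          fun _ => ⟨f, hf, rfl⟩⟩
    choose Z hZ hZj hZi using child
    exact ⟨Z, .single j (hZj j rfl) hZi, hZ⟩
  · have child : ∀ i, ∃ z : UnfoldVar N d, δ i ∈ z.dims ∧
        (δ i + 1 = e → ∃ f : Fin (d + 1), (f : ℕ) + 1 = e ∧ z = .exactly (V i) f) ∧
        (δ i + 1 ≠ e → ∃ f : Fin (d + 1), (f : ℕ) + 2 = e ∧ z = .atMost (V i) f) := fun i => by
      have := hlt i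
      by_cases hi : δ i + 1 = e
      · obtain ⟨f, hf⟩ := index 1 (by omega)
        exact ⟨.exactly (V i) f, UnfoldVar.mem_dims_exactly.2 (by omega), fun _ => ⟨f, hf, rfl⟩,
          fun h => absurd hi h⟩
      · obtain ⟨f, hf⟩ := index 2 (by omega)
        exact ⟨.atMost (V i) f, UnfoldVar.mem_dims_atMost.2 (by omega), fun h => absurd h hi,
          fun _ => ⟨f, hf, rfl⟩⟩
    choose Z hZ hZi hZi' using child
    refine ⟨Z, .multi {i | δ i + 1 = e} ?_ (by simpa using hZi) (by simpa using hZi'), hZ⟩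
    obtain ⟨i, hi, j, hj, hij⟩ := hmax
    exact Finset.one_lt_card.2 ⟨i, by simpa using hi, j, by simpa using hj, hij⟩

end patterns

section rules

variable {T : Type*} {N : Type} {P : Finset (ContextFreeRule T N)} {d : ℕ} {X : N} {e : Fin (d + 1)}
  {out : List (Symbol T (UnfoldVar N d))}

theorem unfoldRule_atMost_iff :
    UnfoldRule P d ⟨.atMost X e, out⟩ ↔
      ∃ e' ≤ e, out = [Symbol.nonterminal (.exactly X e')] := by
  constructor
  · intro h
    generalize hs : (⟨.atMost X e, out⟩ : ContextFreeRule T (UnfoldVar N d)) = s at h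
    cases h with
    | choose Y d' e' h =>
      simp only [ContextFreeRule.mk.injEq, UnfoldVar.atMost.injEq] at hs
      obtain ⟨⟨rfl, rfl⟩, rfl⟩ := hs
      exact ⟨e', h, rfl⟩
    | _ => simp at hs
  · rintro ⟨e', h, rfl⟩
    exact .choose X e e' h

theorem exists_isPattern_of_unfoldRule (h : UnfoldRule P d ⟨.exactly X e, out⟩) :
    ∃ r ∈ P, r.input = X ∧ ∃ Z, IsPattern (varsOf r.output).get e Z ∧ relabel r.output Z = out := by
  generalize hs : (⟨.exactly X e, out⟩ : ContextFreeRule T (UnfoldVar N d)) = s at h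
  cases h with
  | choose => simp at hs
  | leaf r hr h =>
    simp only [ContextFreeRule.mk.injEq, UnfoldVar.exactly.injEq] at hs
    obtain ⟨⟨rfl, rfl⟩, rfl⟩ := hs
    exact ⟨r, hr, rfl, _, .leaf h rfl, rfl⟩
  | unary r hr h d' =>
    simp only [ContextFreeRule.mk.injEq, UnfoldVar.exactly.injEq] at hs
    obtain ⟨⟨rfl, rfl⟩, rfl⟩ := hs
    exact ⟨r, hr, rfl, _, .single ⟨0, by omega⟩ rfl fun i hi => absurd (Fin.ext (by grind)) hi, rfl⟩
  | single r hr h d' e' hd j =>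
    simp only [ContextFreeRule.mk.injEq, UnfoldVar.exactly.injEq] at hs
    obtain ⟨⟨rfl, rfl⟩, rfl⟩ := hs
    exact ⟨r, hr, rfl, _, .single j (if_pos rfl) fun i hi => ⟨e', hd, if_neg hi⟩, rfl⟩
  | multi r hr h d' J hJ Z hZ hZ' =>
    simp only [ContextFreeRule.mk.injEq, UnfoldVar.exactly.injEq] at hs
    obtain ⟨⟨rfl, rfl⟩, rfl⟩ := hs
    exact ⟨r, hr, rfl, Z, .multi J hJ hZ hZ', rfl⟩

theorem IsPattern.unfoldRule {r : ContextFreeRule T N} (hr : r ∈ P)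
    {Z : Fin (varsOf r.output).length → UnfoldVar N d}
    (hZ : IsPattern (varsOf r.output).get e Z) :
    UnfoldRule P d ⟨.exactly r.input e, relabel r.output Z⟩ := by
  cases hZ with
  | leaf hn he =>
    subst he
    convert UnfoldRule.leaf r hr hn with i
    exact absurd i.2 (by omega)
  | single j hj h =>
    rcases (Nat.succ_le_of_lt j.pos).eq_or_lt with hn | hn
    · convert UnfoldRule.unary r hr hn.symm e with i
      rw [show i = j from Fin.ext (by omega), hj]
    · obtain ⟨l, hl⟩ : ∃ l, l ≠ j :=
        have := Fin.nontrivial_iff_two_le.2 hn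
        exists_ne j
      obtain ⟨f, hf, -⟩ := h l hl
      convert UnfoldRule.single r hr hn e f hf j with i
      split_ifs with hij
      · rw [hij, hj]
      · obtain ⟨g, hg, hZ⟩ := h i hij
        rw [hZ, show g = f from Fin.ext (by omega)]
  | multi J hJ h h' =>
    exact .multi r hr (hJ.trans (J.card_le_univ.trans_eq (Fintype.card_fin _))) e J hJ Z h h'

theorem unfoldRule_exactly_iff :
    UnfoldRule P d ⟨.exactly X e, out⟩ ↔
      ∃ r ∈ P, r.input = X ∧
        ∃ Z, IsPattern (varsOf r.output).get e Z ∧ relabel r.output Z = out := by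
  refine ⟨exists_isPattern_of_unfoldRule, ?_⟩
  rintro ⟨r, hr, rfl, Z, hZ, rfl⟩
  exact hZ.unfoldRule hr

end rules

/-! ### The polynomial system of the unfolding -/

section unfoldingSystem

variable {T R : Type*} [CommSemiring R] {N : Type} {d : ℕ}

/-- All patterns for the variables `V i` in dimension `e`. -/
def patterns [Finite N] {n : ℕ} (V : Fin n → N) (e : Fin (d + 1)) :
    Finset (Fin n → UnfoldVar N d) :=
  {Z | IsPattern V e Z}.toFinite.toFinset

theorem mem_patterns [Finite N] {n : ℕ} {V : Fin n → N} {e : Fin (d + 1)}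
    {Z : Fin n → UnfoldVar N d} : Z ∈ patterns V e ↔ IsPattern V e Z :=
  Set.Finite.mem_toFinset _

/-- The series of the variables of the unfolding, given the series for the exact dimensions. -/
def unfoldValue (y : N → ℕ → MvPowerSeries T R) (Z : UnfoldVar N d) : MvPowerSeries T R :=
  ∑ m ∈ Z.dims, y Z.base m

theorem unfoldValue_exactly (y : N → ℕ → MvPowerSeries T R) (X : N) (e : Fin (d + 1)) :
    unfoldValue y (.exactly X e) = y X e :=
  Finset.sum_singleton _ _

theorem unfoldValue_atMost (y : N → ℕ → MvPowerSeries T R) (X : N) (e : Fin (d + 1)) :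
    unfoldValue y (.atMost X e) = ∑ e' ∈ Finset.Iic e, unfoldValue y (.exactly X e') := by
  simp only [unfoldValue_exactly]
  simp only [unfoldValue, UnfoldVar.dims, UnfoldVar.base, ← Fin.map_valEmbedding_Iic,
    Finset.sum_map, Fin.valEmbedding_apply]

theorem sum_patterns_prod_unfoldValue [Finite N] {n : ℕ} (V : Fin n → N) (e : Fin (d + 1))
    (y : N → ℕ → MvPowerSeries T R) :
    ∑ Z ∈ patterns V e, ∏ i, unfoldValue y (Z i) =
      ∑ δ ∈ strahlerFiber n e, ∏ i, y (V i) (δ i) := by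
  classical
  have fiber_eq : strahlerFiber n e =
      (patterns V e).biUnion fun Z => Fintype.piFinset fun i => (Z i).dims := by
    ext δ
    simp only [mem_strahlerFiber, Finset.mem_biUnion, mem_patterns, Fintype.mem_piFinset]
    exact ⟨exists_isPattern V, fun ⟨Z, hZ, hδ⟩ => hZ.strahler_eq hδ⟩
  rw [fiber_eq, Finset.sum_biUnion]
  · refine Finset.sum_congr rfl fun Z hZ => ?_
    simp only [unfoldValue, Finset.prod_univ_sum, (mem_patterns.1 hZ).base_eq]
  · refine fun Z hZ Z' hZ' hne => Finset.disjoint_left.2 fun δ hδ hδ' => hne ?_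
    exact (mem_patterns.1 hZ).eq_of_mem_dims (mem_patterns.1 hZ') (Fintype.mem_piFinset.1 hδ)
      (Fintype.mem_piFinset.1 hδ')

/-- The rules of the unfolding of a set of rules. -/
def unfoldRules [Finite N] (P : Finset (ContextFreeRule T N)) (d : ℕ) :
    Finset (ContextFreeRule T (UnfoldVar N d)) :=
  (finite_setOf_unfoldRule P d).toFinset

theorem mem_unfoldRules [Finite N] {P : Finset (ContextFreeRule T N)}
    {s : ContextFreeRule T (UnfoldVar N d)} : s ∈ unfoldRules P d ↔ UnfoldRule P d s :=
  Set.Finite.mem_toFinset _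

theorem grammarPoly_eq_of_mem_iff {N : Type*} (P : Finset (ContextFreeRule T N)) (X : N)
    (O : Finset (List (Symbol T N))) (hO : ∀ out, ⟨X, out⟩ ∈ P ↔ out ∈ O)
    (y : N → MvPowerSeries T R) :
    grammarPoly P X y =
      ∑ out ∈ O, MvPowerSeries.monomial (terminalParikh out) 1 * ((varsOf out).map y).prod := by
  classical
  have mk_output : ∀ r ∈ P.filter (·.input = X), ⟨X, r.output⟩ = r := fun r hr => by
    obtain rfl := (Finset.mem_filter.1 hr).2
    rfl
  refine Finset.sum_bij' (fun r _ => r.output) (fun out _ => ⟨X, out⟩) (fun r hr => ?_)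
    (fun out hout => Finset.mem_filter.2 ⟨(hO out).2 hout, rfl⟩) mk_output (fun _ _ => rfl)
    fun _ _ => rfl
  exact (hO _).1 (mk_output r hr ▸ (Finset.mem_filter.1 hr).1)

theorem grammarPoly_atMost [Finite N] (P : Finset (ContextFreeRule T N)) (X : N)
    (e : Fin (d + 1)) (y : UnfoldVar N d → MvPowerSeries T R) :
    grammarPoly (unfoldRules P d) (.atMost X e) y = ∑ e' ∈ Finset.Iic e, y (.exactly X e') := by
  classical
  rw [grammarPoly_eq_of_mem_iff _ _
    ((Finset.Iic e).image fun e' => [Symbol.nonterminal (.exactly X e')]), Finset.sum_image]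
  · refine Finset.sum_congr rfl fun e' _ => ?_
    simp only [terminalParikh, varsOf, List.map_cons, List.map_nil, List.prod_singleton,
      MvPowerSeries.monomial_zero_one, one_mul]
  · intro a _ b _ hab
    simpa using hab
  · intro out
    simp only [mem_unfoldRules, unfoldRule_atMost_iff, Finset.mem_image, Finset.mem_Iic, eq_comm]

theorem grammarPoly_exactly [Finite N] (P : Finset (ContextFreeRule T N)) (X : N)
    (e : Fin (d + 1)) (y : N → ℕ → MvPowerSeries T R) :
    grammarPoly (unfoldRules P d) (.exactly X e) (unfoldValue y) =
      attrPoly P X (fun r => strahlerFiber (varsOf r.output).length e) y := by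
  classical
  rw [grammarPoly_eq_of_mem_iff _ _ (({r ∈ P | r.input = X}).biUnion fun r =>
    (patterns (varsOf r.output).get e).image (relabel r.output)), Finset.sum_biUnion]
  · refine Finset.sum_congr rfl fun r _ => ?_
    rw [Finset.sum_image ((relabel_injective r.output).injOn), ← sum_patterns_prod_unfoldValue,
      Finset.mul_sum]
    refine Finset.sum_congr rfl fun Z _ => ?_
    rw [terminalParikh_relabel, varsOf_relabel, List.map_ofFn, List.prod_ofFn]
    rfl
  · refine fun r hr r' hr' hne => Finset.disjoint_left.2 fun out hout hout' => hne ?_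
    obtain ⟨Z, hZ, rfl⟩ := Finset.mem_image.1 hout
    obtain ⟨Z', hZ', h⟩ := Finset.mem_image.1 hout'
    have output_eq : r.output = r'.output := by
      rw [← map_relabel UnfoldVar.base r.output Z (mem_patterns.1 hZ).base_eq, ← h,
        map_relabel UnfoldVar.base r'.output Z' (mem_patterns.1 hZ').base_eq]
    have input_eq : r.input = r'.input :=
      (Finset.mem_filter.1 hr).2.trans (Finset.mem_filter.1 hr').2.symm
    cases r
    cases r'
    exact congrArg₂ _ input_eq output_eq
  · intro out
    simp only [mem_unfoldRules, unfoldRule_exactly_iff, Finset.mem_biUnion, Finset.mem_filter,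
      Finset.mem_image, mem_patterns, and_assoc]

end unfoldingSystem

section unfoldGrammar

variable {T : Type*} {G : ContextFreeGrammar T} [Finite G.NT] {d : ℕ}

theorem unfoldValue_camb_unfoldGrammar (y : G.NT → ℕ → MvPowerSeries T ℕ∞)
    (hy : ∀ X (e : Fin (d + 1)), y X e = camb (unfoldGrammar G d) (.exactly X e)) :
    unfoldValue y = camb (unfoldGrammar G d) := by
  funext Z
  cases Z with
  | exactly X e => rw [unfoldValue_exactly, hy]
  | atMost X e =>
    simp only [unfoldValue_atMost, unfoldValue_exactly, hy]
    exact ((camb_eq_grammarPoly _).trans (grammarPoly_atMost G.rules X e _)).symm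

theorem camb_unfoldGrammar (Z : UnfoldVar G.NT d) :
    camb (unfoldGrammar G d) Z = unfoldValue (dimSeries G) Z := by
  apply le_antisymm
  · refine camb_le (G := unfoldGrammar G d) (y := unfoldValue (dimSeries G)) (fun Z => ?_) Z
    cases Z with
    | atMost X e => exact ((grammarPoly_atMost _ _ _ _).trans (unfoldValue_atMost _ _ _).symm).le
    | exactly X e =>
      refine ((grammarPoly_exactly _ _ _ _).trans ?_).le
      rw [unfoldValue_exactly, ← dimSeries_eq_attrPoly]
  · let y : G.NT → ℕ → MvPowerSeries T ℕ∞ := fun X m =>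
      if h : m < d + 1 then camb (unfoldGrammar G d) (.exactly X ⟨m, h⟩) else 0
    have hy : ∀ X (e : Fin (d + 1)), y X e = camb (unfoldGrammar G d) (.exactly X e) :=
      fun X e => dif_pos e.2
    have unfoldValue_y := unfoldValue_camb_unfoldGrammar y hy
    have dimSeries_le : ∀ X, ∀ m ≤ d, dimSeries G X m ≤ y X m := fun X m hm => by
      refine map_dimSeries_le finitelyDetermined_id (fun X e he => ?_) X hm
      have h := camb_eq_grammarPoly (G := unfoldGrammar G d)
        (.exactly X ⟨e, Nat.lt_succ_of_le he⟩)
      rw [← hy, ← unfoldValue_y] at h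
      exact (h.trans (grammarPoly_exactly _ _ _ _)).ge
    rw [← unfoldValue_y]
    refine Finset.sum_le_sum fun m hm => dimSeries_le _ m ?_
    cases Z with
    | atMost X e => exact (UnfoldVar.mem_dims_atMost.1 hm).trans e.is_le
    | exactly X e => exact (UnfoldVar.mem_dims_exactly.1 hm).trans_le e.is_le

end unfoldGrammar

/-! ### Truncation at the dimension `n + log log k` -/

section truncation

variable {T : Type*} {G : ContextFreeGrammar T}

theorem sum_dimSeries_Iic (X : G.NT) (d : ℕ) :
    ∑ e ∈ Finset.Iic d, dimSeries G X e =
      weightSeries DerivTree.parikh {t : DerivTree G X | t.dim ≤ d} := by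
  have biUnion_eq : {t : DerivTree G X | t.dim ≤ d} =
      ⋃ e ∈ Finset.Iic d, {t : DerivTree G X | t.dim = e} := by
    ext t
    simp
  rw [biUnion_eq, weightSeries_biUnion]
  · rfl
  · exact fun e _ e' _ hne => Set.disjoint_left.2 fun t ht ht' => hne (ht.symm.trans ht')

theorem camb_unfoldGrammar_atMost [Finite G.NT] {d : ℕ} (X : G.NT) (e : Fin (d + 1)) :
    camb (unfoldGrammar G d) (.atMost X e) =
      weightSeries DerivTree.parikh {t : DerivTree G X | t.dim ≤ e} :=
  (camb_unfoldGrammar _).trans (sum_dimSeries_Iic X e)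

theorem cambMod_eq_map (k : ℕ) (X : G.NT) :
    cambMod k G X = MvPowerSeries.map (CollapsedNat.ofENatHom k) (camb G X) := rfl

theorem CollapsedNat.ofENat_eq_of_le {k : ℕ} {x y : ℕ∞} (hx : k ≤ x) (hy : k ≤ y) :
    ofENat k x = ofENat k y := by
  rw [ofENat, ofENat, min_eq_right hx, min_eq_right hy]

theorem le_two_pow_two_pow_logLog (k : ℕ) : k ≤ 2 ^ 2 ^ logLog k := by
  rcases Nat.lt_or_ge k 2 with hk | hk
  · exact (Nat.le_of_lt_succ hk).trans Nat.one_le_two_pow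
  have one_lt : (1 : ℝ) < k := by exact_mod_cast hk
  have h : Real.logb 2 (Real.logb 2 k) ≤ logLog k := Nat.le_ceil _
  rw [Real.logb_le_iff_le_rpow one_lt_two (Real.logb_pos one_lt_two one_lt),
    Real.logb_le_iff_le_rpow one_lt_two (one_pos.trans one_lt)] at h
  exact_mod_cast h

theorem le_encard_setOf_parikh_eq [Fintype G.NT] (k : ℕ) {X : G.NT} (t : DerivTree G X)
    (ht : Fintype.card G.NT + logLog k < t.dim) :
    (k : ℕ∞) ≤ {s : DerivTree G X |
      s.dim ≤ Fintype.card G.NT + logLog k ∧ s.parikh = t.parikh}.encard := by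
  have le_encard_variants : (k : ℕ∞) ≤ (t.variants (Fintype.card G.NT + logLog k)).encard :=
    calc (k : ℕ∞) ≤ 2 ^ 2 ^ logLog k := mod_cast le_two_pow_two_pow_logLog k
      _ ≤ _ := t.two_pow_two_pow_le_encard_variants (logLog k) ht
  exact le_encard_variants.trans (Set.encard_le_encard fun s hs =>
    ⟨hs.2, by rw [s.parikh_eq_sum, t.parikh_eq_sum, hs.1]⟩)

theorem cambMod_eq_map_weightSeries_dim_le [Fintype G.NT] (k : ℕ) (X : G.NT) :
    cambMod k G X = MvPowerSeries.map (CollapsedNat.ofENatHom k)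
      (weightSeries DerivTree.parikh
        {t : DerivTree G X | t.dim ≤ Fintype.card G.NT + logLog k}) := by
  rw [cambMod_eq_map, camb_eq_weightSeries]
  ext v
  simp only [MvPowerSeries.coeff_map, coeff_weightSeries, Set.mem_univ, true_and]
  by_cases h : ∀ t : DerivTree G X, t.parikh = v → t.dim ≤ Fintype.card G.NT + logLog k
  · congr 2
    ext t
    exact ⟨fun ht => ⟨h t ht, ht⟩, And.right⟩
  · push Not at h
    obtain ⟨t, rfl, ht⟩ := h
    have hk := le_encard_setOf_parikh_eq k t ht
    exact CollapsedNat.ofENat_eq_of_le (hk.trans (Set.encard_le_encard fun _ => And.right)) hk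

theorem cambModAtMost_eq_cambMod [Fintype G.NT] (k : ℕ) (X : G.NT) :
    cambModAtMost k G X (Fintype.card G.NT + logLog k) = cambMod k G X := by
  rw [cambMod_eq_map_weightSeries_dim_le]
  exact congrArg (MvPowerSeries.map (CollapsedNat.ofENatHom k))
    (camb_unfoldGrammar_atMost X (Fin.last _))

theorem isRationalSeries_cambMod [Finite G.NT] (k : ℕ) (X : G.NT) :
    IsRationalSeries (cambMod k G X) := by
  cases nonempty_fintype G.NT
  rw [cambMod_eq_map_weightSeries_dim_le, ← sum_dimSeries_Iic, map_sum]
  exact .sum _ fun e _ => isRationalSeries_map_dimSeries (finitelyDetermined_ofENatHom k) X e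

end truncation

end

theorem mainTheorem3_general {T : Type*} (G : ContextFreeGrammar T) [Fintype G.NT] (X : G.NT)
    (k : ℕ) :
    cambModAtMost k G X (Fintype.card G.NT + logLog k) = cambMod k G X ∧
      IsRationalSeries (cambMod k G X) :=
  ⟨cambModAtMost_eq_cambMod k X, isRationalSeries_cambMod k X⟩

theorem mainTheorem3 {T : Type*} [Finite T] (G : ContextFreeGrammar T) [Fintype G.NT]
    (X : G.NT) (k : ℕ) (hk : 0 < k) :
    cambModAtMost k G X (Fintype.card G.NT + logLog k) = cambMod k G X ∧
      IsRationalSeries (cambMod k G X) :=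
  mainTheorem3_general G X k
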